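/- Let $(M,g)$ be a flat $m$-dimensional Riemannian manifold with Levi-Civita connection $\nabla$ (flat means that the curvature tensor of $\nabla$ vanishes), and let $f:M\to\,]0,+\infty[$ be a smooth function. For $X\in T_xM$ and $(x,u)\in TM$ let $X^H,X^V\in T_{(x,u)}TM$ be the horizontal lift (with respect to $\nabla$) and the vertical lift. The Sasaki metric $\widehat g$ and the Mus-Sasaki metric $\widetilde g$ on $TM$ are given by $$\widehat g(X^H,Y^H)=g(X,Y),\quad \widehat g(X^H,Y^V)=0,\quad \widehat g(X^V,Y^V)=g(X,Y),$$ $$\widetilde g(X^H,Y^H)=g(X,Y),\quad \widetilde g(X^H,Y^V)=0,\quad \widetilde g(X^V,Y^V)=f(x)\,g(X,Y)$$ at $(x,u)$. A smooth map $\varphi:(P,h)\to(N,k)$ of Riemannian manifolds is harmonic if its tension field $\tau(\varphi)=\mathrm{Tr}_h\nabla d\varphi$ vanishes, biharmonic if its bitension field $$\tau_2(\varphi)=-\mathrm{Tr}_h R^N(\tau(\varphi),d\varphi)d\varphi-\mathrm{Tr}_h\big(\nabla^\varphi\nabla^\varphi\tau(\varphi)-\nabla^\varphi_{\nabla^P}\tau(\varphi)\big)$$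 vanishes, and proper biharmonic if it is biharmonic but not harmonic; here $\nabla^P$ is the Levi-Civita connection of $(P,h)$, $R^N$ is the curvature tensor of $(N,k)$, and $\nabla^\varphi$ is the pull-back by $\varphi$ of the Levi-Civita connection of $(N,k)$. **Theorem 5.4.** The identity map $\mathrm{Id}:(TM,\widehat g)\to(TM,\widetilde g)$ is biharmonic if and only if $$\frac m4\,\mathrm{grad}\big(\|\mathrm{grad} f\|^2\big)=\mathrm{Tr}_g\nabla^2(\mathrm{grad} f)\quad\text{on } M, \qquad (\ast)$$ where $\nabla^2_{X,Y}Z=\nabla_X\nabla_YZ-\nabla_{\nabla_XY}Z$. It is proper biharmonic if and only if $(\ast)$ holds and $\mathrm{grad} f$ does not vanish identically (for connected $M$: $f$ is not constant). -/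

import Mathlib

set_option maxSynthPendingDepth 3

open scoped Manifold ContDiff

noncomputable section

namespace MusSasaki

/-! ## Riemannian geometry in an open subset of a vector space

`G` is the coordinate expression of a metric: `G y v w = ∑ g_ij(y) vⁱ wʲ`. -/

section LocalGeometry

variable {E : Type*} [NormedAddCommGroup E] [NormedSpace ℝ E]
  {F : Type*} [NormedAddCommGroup F] [NormedSpace ℝ F]

/-- The Christoffel symbols of the first kind:
`koszul G y v w z = ½ (∂_v g(w,z) + ∂_w g(v,z) - ∂_z g(v,w))`. -/
def koszul (G : E → E →L[ℝ] E →L[ℝ] ℝ) (y : E) : E →L[ℝ] E →L[ℝ] E →L[ℝ] ℝ :=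
  let D : E →L[ℝ] E →L[ℝ] E →L[ℝ] ℝ := fderiv ℝ G y
  let T : (E →L[ℝ] E →L[ℝ] ℝ) →L[ℝ] E →L[ℝ] E →L[ℝ] ℝ :=
    (ContinuousLinearMap.flipₗᵢ ℝ E E ℝ).toContinuousLinearEquiv.toContinuousLinearMap
  (1 / 2 : ℝ) • (D + D.flip - T.comp D.flip)

theorem koszul_apply (G : E → E →L[ℝ] E →L[ℝ] ℝ) (y v w z : E) :
    koszul G y v w z
      = (1 / 2) * (fderiv ℝ G y v w z + fderiv ℝ G y w v z - fderiv ℝ G y z v w) := by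
  simp [koszul]

/-- The Christoffel symbols of the Levi-Civita connection, `Γ(v,w)ᵏ = ∑ Γᵏ_ij vⁱ wʲ`:
`christoffel G y v w` is the vector `a` with `G y a z = koszul G y v w z` for all `z`. -/
def christoffel (G : E → E →L[ℝ] E →L[ℝ] ℝ) (y : E) : E →L[ℝ] E →L[ℝ] E :=
  (ContinuousLinearMap.compL ℝ E (E →L[ℝ] ℝ) E (G y).inverse).comp (koszul G y)

theorem christoffel_apply (G : E → E →L[ℝ] E →L[ℝ] ℝ) (y v w : E) :
    christoffel G y v w = (G y).inverse (koszul G y v w) := rfl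

/-- The curvature tensor `R(u,v)w = ∇_u ∇_v w - ∇_v ∇_u w - ∇_[u,v] w` in coordinates
(evaluated on constant fields `u v w`, for which `[u,v] = 0`). -/
def curvature (G : E → E →L[ℝ] E →L[ℝ] ℝ) (y u v w : E) : E :=
  fderiv ℝ (fun z => christoffel G z v w) y u - fderiv ℝ (fun z => christoffel G z u w) y v
    + christoffel G y u (christoffel G y v w) - christoffel G y v (christoffel G y u w)

/-- The trace `∑ g^ij B(e_i, e_j)` of a bilinear map with respect to the scalar product `G`;
`G⁻¹ (eⁱ) = ∑ g^ij e_j`. -/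
def metricTrace [FiniteDimensional ℝ E] (G : E →L[ℝ] E →L[ℝ] ℝ) (B : E → E → F) : F :=
  ∑ i, B (Module.finBasis ℝ E i)
    (G.inverse ((Module.finBasis ℝ E).coord i).toContinuousLinearMap)

/-- The pull-back connection: `(∇^φ_v V)(y) = D_v V + Γ(dφ(v), V)` for a vector field `V` along
`φ`, where `Γ` belongs to the metric `GN` of the target. -/
def pullbackCov (GN : F → F →L[ℝ] F →L[ℝ] ℝ) (φ V : E → F) (y v : E) : F :=
  fderiv ℝ V y v + christoffel GN (φ y) (fderiv ℝ φ y v) (V y)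

/-- `(∇dφ)(v,w) = ∇^φ_v (dφ w) - dφ(∇_v w)`, evaluated with `w` extended as a constant field. -/
def secondFundForm (GM : E → E →L[ℝ] E →L[ℝ] ℝ) (GN : F → F →L[ℝ] F →L[ℝ] ℝ) (φ : E → F)
    (y v w : E) : F :=
  pullbackCov GN φ (fun z => fderiv ℝ φ z w) y v - fderiv ℝ φ y (christoffel GM y v w)

/-- `∇²_{v,w} V = ∇^φ_v ∇^φ_w V - ∇^φ_{∇_v w} V`, evaluated with `w` extended as a constant
field. -/
def secondCov (GM : E → E →L[ℝ] E →L[ℝ] ℝ) (GN : F → F →L[ℝ] F →L[ℝ] ℝ) (φ V : E → F)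
    (y v w : E) : F :=
  pullbackCov GN φ (fun z => pullbackCov GN φ V z w) y v
    - pullbackCov GN φ V y (christoffel GM y v w)

/-- `Tr_g (∇^φ ∇^φ - ∇^φ_∇) V`. -/
def traceSecondCov [FiniteDimensional ℝ E] (GM : E → E →L[ℝ] E →L[ℝ] ℝ)
    (GN : F → F →L[ℝ] F →L[ℝ] ℝ) (φ V : E → F) (y : E) : F :=
  metricTrace (GM y) (secondCov GM GN φ V y)

/-- The tension field `τ(φ) = Tr_g ∇dφ`. -/
def localTension [FiniteDimensional ℝ E] (GM : E → E →L[ℝ] E →L[ℝ] ℝ)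
    (GN : F → F →L[ℝ] F →L[ℝ] ℝ) (φ : E → F) (y : E) : F :=
  metricTrace (GM y) (secondFundForm GM GN φ y)

/-- The bitension field
`τ₂(φ) = - Tr_g R^N(τ(φ), dφ) dφ - Tr_g (∇^φ ∇^φ τ(φ) - ∇^φ_∇ τ(φ))`. -/
def localBitension [FiniteDimensional ℝ E] (GM : E → E →L[ℝ] E →L[ℝ] ℝ)
    (GN : F → F →L[ℝ] F →L[ℝ] ℝ) (φ : E → F) (y : E) : F :=
  - metricTrace (GM y) (fun v w =>
      curvature GN (φ y) (localTension GM GN φ y) (fderiv ℝ φ y v) (fderiv ℝ φ y w))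
    - traceSecondCov GM GN φ (localTension GM GN φ) y

end LocalGeometry

/-- The bilinear form `(v, w) ↦ B (L v, L w)`. -/
def pullForm {V W : Type*} [AddCommGroup V] [Module ℝ V] [TopologicalSpace V]
    [IsTopologicalAddGroup V] [ContinuousSMul ℝ V] [AddCommGroup W] [Module ℝ W]
    [TopologicalSpace W] [IsTopologicalAddGroup W] [ContinuousSMul ℝ W]
    (B : V →L[ℝ] V →L[ℝ] ℝ) (L : W →L[ℝ] V) : W →L[ℝ] W →L[ℝ] ℝ :=
  (L.precomp ℝ).comp (B.comp L)

theorem pullForm_apply {V W : Type*} [AddCommGroup V] [Module ℝ V] [TopologicalSpace V]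
    [IsTopologicalAddGroup V] [ContinuousSMul ℝ V] [AddCommGroup W] [Module ℝ W]
    [TopologicalSpace W] [IsTopologicalAddGroup W] [ContinuousSMul ℝ W]
    (B : V →L[ℝ] V →L[ℝ] ℝ) (L : W →L[ℝ] V) (v w : W) : pullForm B L v w = B (L v) (L w) := rfl

/-! ## Manifolds without boundary, with a metric tensor field

Near a point `p` everything is expressed in the preferred chart `extChartAt I p`; the
trivialization of the tangent bundle at `p` is the one given by the differential of that chart. -/

section Manifold

variable {E : Type*} [NormedAddCommGroup E] [NormedSpace ℝ E]
  {H : Type*} [TopologicalSpace H] (I : ModelWithCorners ℝ E H)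
  {M : Type*} [TopologicalSpace M] [ChartedSpace H M] [IsManifold I 1 M]
  {F : Type*} [NormedAddCommGroup F] [NormedSpace ℝ F]
  {H' : Type*} [TopologicalSpace H'] (J : ModelWithCorners ℝ F H')
  {N : Type*} [TopologicalSpace N] [ChartedSpace H' N] [IsManifold J 1 N]

/-- The components of the metric `g` in the chart at `p`. -/
def metricInChart (g : ∀ x : M, TangentSpace I x →L[ℝ] TangentSpace I x →L[ℝ] ℝ) (p : M) :
    E → E →L[ℝ] E →L[ℝ] ℝ := fun y =>
  pullForm (g ((extChartAt I p).symm y))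
    ((trivializationAt E (TangentSpace I : M → Type _) p).symmL ℝ ((extChartAt I p).symm y))

/-- The components of the vector field `X` in the chart at `p`. -/
def fieldInChart (X : ∀ x : M, TangentSpace I x) (p : M) : E → E := fun y =>
  (trivializationAt E (TangentSpace I : M → Type _) p).continuousLinearMapAt ℝ
    ((extChartAt I p).symm y) (X ((extChartAt I p).symm y))

/-- The metric `g` is flat: its curvature tensor vanishes, in all the preferred charts. -/
def IsFlat (g : ∀ x : M, TangentSpace I x →L[ℝ] TangentSpace I x →L[ℝ] ℝ) : Prop :=
  ∀ p : M, ∀ y ∈ (extChartAt I p).target, ∀ u v w : E,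
    curvature (metricInChart I g p) y u v w = 0

/-- The gradient of `f`: `g (grad f, v) = df(v)`. -/
def grad (g : ∀ x : M, TangentSpace I x →L[ℝ] TangentSpace I x →L[ℝ] ℝ) (f : M → ℝ) (x : M) :
    TangentSpace I x :=
  (g x).inverse (mvfderiv I f x)

/-- The function `‖X‖²` of a vector field `X`. -/
def normSq (g : ∀ x : M, TangentSpace I x →L[ℝ] TangentSpace I x →L[ℝ] ℝ)
    (X : ∀ x : M, TangentSpace I x) (x : M) : ℝ :=
  g x (X x) (X x)

/-- The vector field `Tr_g ∇² X`, where `∇²_{v,w} X = ∇_v ∇_w X - ∇_{∇_v w} X` and `∇` is the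
Levi-Civita connection of `g`. -/
def traceHess [FiniteDimensional ℝ E]
    (g : ∀ x : M, TangentSpace I x →L[ℝ] TangentSpace I x →L[ℝ] ℝ)
    (X : ∀ x : M, TangentSpace I x) (p : M) : TangentSpace I p :=
  (trivializationAt E (TangentSpace I : M → Type _) p).symmL ℝ p
    (traceSecondCov (metricInChart I g p) (metricInChart I g p) id (fieldInChart I X p)
      (extChartAt I p p))

/-- The tension field of `φ : (M, g) → (N, h)`, a vector field along `φ`. -/
def tension [FiniteDimensional ℝ E]
    (g : ∀ x : M, TangentSpace I x →L[ℝ] TangentSpace I x →L[ℝ] ℝ)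
    (h : ∀ x : N, TangentSpace J x →L[ℝ] TangentSpace J x →L[ℝ] ℝ) (φ : M → N) (p : M) :
    TangentSpace J (φ p) :=
  (trivializationAt F (TangentSpace J : N → Type _) (φ p)).symmL ℝ (φ p)
    (localTension (metricInChart I g p) (metricInChart J h (φ p))
      (writtenInExtChartAt I J p φ) (extChartAt I p p))

/-- The bitension field of `φ : (M, g) → (N, h)`, a vector field along `φ`. -/
def bitension [FiniteDimensional ℝ E]
    (g : ∀ x : M, TangentSpace I x →L[ℝ] TangentSpace I x →L[ℝ] ℝ)
    (h : ∀ x : N, TangentSpace J x →L[ℝ] TangentSpace J x →L[ℝ] ℝ) (φ : M → N) (p : M) :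
    TangentSpace J (φ p) :=
  (trivializationAt F (TangentSpace J : N → Type _) (φ p)).symmL ℝ (φ p)
    (localBitension (metricInChart I g p) (metricInChart J h (φ p))
      (writtenInExtChartAt I J p φ) (extChartAt I p p))

/-- A smooth map with vanishing tension field. -/
def IsHarmonic [FiniteDimensional ℝ E]
    (g : ∀ x : M, TangentSpace I x →L[ℝ] TangentSpace I x →L[ℝ] ℝ)
    (h : ∀ x : N, TangentSpace J x →L[ℝ] TangentSpace J x →L[ℝ] ℝ) (φ : M → N) : Prop :=
  ContMDiff I J ∞ φ ∧ ∀ p, tension I J g h φ p = 0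

/-- A smooth map with vanishing bitension field. -/
def IsBiharmonic [FiniteDimensional ℝ E]
    (g : ∀ x : M, TangentSpace I x →L[ℝ] TangentSpace I x →L[ℝ] ℝ)
    (h : ∀ x : N, TangentSpace J x →L[ℝ] TangentSpace J x →L[ℝ] ℝ) (φ : M → N) : Prop :=
  ContMDiff I J ∞ φ ∧ ∀ p, bitension I J g h φ p = 0

/-- A biharmonic map that is not harmonic. -/
def IsProperBiharmonic [FiniteDimensional ℝ E]
    (g : ∀ x : M, TangentSpace I x →L[ℝ] TangentSpace I x →L[ℝ] ℝ)
    (h : ∀ x : N, TangentSpace J x →L[ℝ] TangentSpace J x →L[ℝ] ℝ) (φ : M → N) : Prop :=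
  IsBiharmonic I J g h φ ∧ ¬ IsHarmonic I J g h φ

end Manifold

/-! ## The tangent bundle

The chart of `TM` at `p = (x, u)` is the one induced by the chart of `M` at `x`, so an element of
`T_p TM` is a pair `(a, b) = ∑ aⁱ ∂/∂xⁱ + ∑ bⁱ ∂/∂yⁱ` of vectors. -/

section TangentBundle

variable {E : Type*} [NormedAddCommGroup E] [NormedSpace ℝ E]
  {H : Type*} [TopologicalSpace H] (I : ModelWithCorners ℝ E H)
  {M : Type*} [TopologicalSpace M] [ChartedSpace H M] [IsManifold I 1 M]

/-- The Christoffel symbols of `g` at the point `x`, in the chart at `x`. -/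
def christoffelAt (g : ∀ x : M, TangentSpace I x →L[ℝ] TangentSpace I x →L[ℝ] ℝ) (x : M) :
    TangentSpace I x →L[ℝ] TangentSpace I x →L[ℝ] TangentSpace I x :=
  (christoffel (metricInChart I g x) (extChartAt I x x) : E →L[ℝ] E →L[ℝ] E)

/-- The vertical lift `X^V = Xⁱ ∂/∂yⁱ` to the point `p = (x, u)`. -/
def verticalLift (p : TangentBundle I M) (X : TangentSpace I p.1) : TangentSpace I.tangent p :=
  ((0 : E), (X : E))

/-- The horizontal lift `X^H = Xⁱ (∂/∂xⁱ - uʲ Γᵏ_ij ∂/∂yᵏ)` to the point `p = (x, u)`. -/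
def horizontalLift (g : ∀ x : M, TangentSpace I x →L[ℝ] TangentSpace I x →L[ℝ] ℝ)
    (p : TangentBundle I M) (X : TangentSpace I p.1) : TangentSpace I.tangent p :=
  ((X : E), (-christoffelAt I g p.1 X p.2 : E))

/-- The horizontal component `X` of a vector `A = X^H + Y^V`. -/
def horPart (p : TangentBundle I M) : TangentSpace I.tangent p →L[ℝ] TangentSpace I p.1 :=
  ContinuousLinearMap.fst ℝ E E

/-- The vertical component `Y` of a vector `A = X^H + Y^V`. -/
def verPart (g : ∀ x : M, TangentSpace I x →L[ℝ] TangentSpace I x →L[ℝ] ℝ)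
    (p : TangentBundle I M) : TangentSpace I.tangent p →L[ℝ] TangentSpace I p.1 :=
  (ContinuousLinearMap.snd ℝ E E +
    ((christoffel (metricInChart I g p.1) (extChartAt I p.1 p.1)).flip (p.2 : E)).comp
      (ContinuousLinearMap.fst ℝ E E) :
    E × E →L[ℝ] E)

theorem horizontalLift_add_verticalLift
    (g : ∀ x : M, TangentSpace I x →L[ℝ] TangentSpace I x →L[ℝ] ℝ)
    (p : TangentBundle I M) (A : TangentSpace I.tangent p) :
    horizontalLift I g p (horPart I p A) + verticalLift I p (verPart I g p A) = A := by
  refine Prod.ext (add_zero _) ?_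
  let a : E := A.2
  let c : E := christoffelAt I g p.1 (horPart I p A) p.2
  change -c + (a + c) = a
  abel

/-- The Mus-Sasaki metric of `g` and the weight `f` on the tangent bundle:
`g̃(X^H, Y^H) = g(X, Y)`, `g̃(X^H, Y^V) = 0`, `g̃(X^V, Y^V) = f g(X, Y)`. -/
def musSasaki (g : ∀ x : M, TangentSpace I x →L[ℝ] TangentSpace I x →L[ℝ] ℝ) (f : M → ℝ)
    (p : TangentBundle I M) :
    TangentSpace I.tangent p →L[ℝ] TangentSpace I.tangent p →L[ℝ] ℝ :=
  pullForm (g p.1) (horPart I p) + f p.1 • pullForm (g p.1) (verPart I g p)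

/-- The Sasaki metric of `g` on the tangent bundle:
`ĝ(X^H, Y^H) = g(X, Y)`, `ĝ(X^H, Y^V) = 0`, `ĝ(X^V, Y^V) = g(X, Y)`. -/
def sasaki (g : ∀ x : M, TangentSpace I x →L[ℝ] TangentSpace I x →L[ℝ] ℝ)
    (p : TangentBundle I M) :
    TangentSpace I.tangent p →L[ℝ] TangentSpace I.tangent p →L[ℝ] ℝ :=
  pullForm (g p.1) (horPart I p) + pullForm (g p.1) (verPart I g p)

theorem horPart_horizontalLift (g : ∀ x : M, TangentSpace I x →L[ℝ] TangentSpace I x →L[ℝ] ℝ)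
    (p : TangentBundle I M) (X : TangentSpace I p.1) :
    horPart I p (horizontalLift I g p X) = X := rfl

theorem horPart_verticalLift (p : TangentBundle I M) (X : TangentSpace I p.1) :
    horPart I p (verticalLift I p X) = 0 := rfl

theorem verPart_horizontalLift (g : ∀ x : M, TangentSpace I x →L[ℝ] TangentSpace I x →L[ℝ] ℝ)
    (p : TangentBundle I M) (X : TangentSpace I p.1) :
    verPart I g p (horizontalLift I g p X) = 0 :=
  neg_add_cancel (christoffelAt I g p.1 X p.2 : E)

theorem verPart_verticalLift (g : ∀ x : M, TangentSpace I x →L[ℝ] TangentSpace I x →L[ℝ] ℝ)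
    (p : TangentBundle I M) (X : TangentSpace I p.1) :
    verPart I g p (verticalLift I p X) = X := by
  change (X + christoffelAt I g p.1 0 p.2 : TangentSpace I p.1) = X
  rw [map_zero, zero_apply, add_zero]

/-- The three identities that characterize the metric `musSasaki`. -/
theorem musSasaki_lifts (g : ∀ x : M, TangentSpace I x →L[ℝ] TangentSpace I x →L[ℝ] ℝ)
    (f : M → ℝ) (p : TangentBundle I M) (X Y : TangentSpace I p.1) :
    musSasaki I g f p (horizontalLift I g p X) (horizontalLift I g p Y) = g p.1 X Y ∧
    musSasaki I g f p (horizontalLift I g p X) (verticalLift I p Y) = 0 ∧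
    musSasaki I g f p (verticalLift I p X) (verticalLift I p Y) = f p.1 * g p.1 X Y := by
  simp [musSasaki, pullForm_apply, horPart_horizontalLift, horPart_verticalLift,
    verPart_horizontalLift, verPart_verticalLift]

/-- The three identities that characterize the metric `sasaki`. -/
theorem sasaki_lifts (g : ∀ x : M, TangentSpace I x →L[ℝ] TangentSpace I x →L[ℝ] ℝ)
    (p : TangentBundle I M) (X Y : TangentSpace I p.1) :
    sasaki I g p (horizontalLift I g p X) (horizontalLift I g p Y) = g p.1 X Y ∧
    sasaki I g p (horizontalLift I g p X) (verticalLift I p Y) = 0 ∧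
    sasaki I g p (verticalLift I p X) (verticalLift I p Y) = g p.1 X Y := by
  simp [sasaki, pullForm_apply, horPart_horizontalLift, horPart_verticalLift,
    verPart_horizontalLift, verPart_verticalLift]

end TangentBundle

end MusSasaki

end

/-! Write `X` for `grad f` and split tangent vectors of `TM` into horizontal and vertical
components. The Levi-Civita connection of the Mus-Sasaki metric differentiates both components by
`∇` and adds `-½ g(ver A, ver B) X` to the horizontal one and `(1/2f)(df(A) ver B + df(B) ver A)` to
the vertical one (`IsMetricOn.christoffel_bundleMetric`). This connection is metric, and flatness
makes it torsion free. The Sasaki metric is the case `f = 1`.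

The tension field of the identity is the Sasaki trace of the difference of the two connections. Only
the `m` vertical vectors of an adapted orthonormal frame contribute, so `τ = -(m/2) X^H`. For the
bitension field, `R(t^H, e^H) e^H = 0` and `R(t^H, b^V) b^V = ‖b‖² (-½ ∇_t X + (df(t)/4f) X)^H`,
while the trace of the second covariant derivative of `T^H` is `(Tr ∇²T - (m df(T)/4f) X)^H`. The
terms with `1/f` cancel and leave `(m/2) (Tr ∇²X - (m/2) ∇_X X)^H`
(`IsFlatWeighted.localBitension_eq`). Since the Hessian of `f` is symmetric, `grad ‖X‖² = 2 ∇_X X`,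
and the vanishing of this vector is the stated equation.

All this is computed in one chart, whereas the metric at each point of `TM` is defined by the
Christoffel symbols of the preferred chart at that point. The transformation law of Christoffel
symbols bridges the gap (`metricInChart_musSasaki`). -/

noncomputable section

namespace MusSasaki

open scoped Topology
open Filter Set

/-! ### Levi-Civita connection of a metric on an open set -/

section MetricOn

variable {E : Type*} [NormedAddCommGroup E] [NormedSpace ℝ E]
  {F : Type*} [NormedAddCommGroup F] [NormedSpace ℝ F]

/-- `G` is a smooth Riemannian metric on the open set `U`. -/
structure IsMetricOn (G : E → E →L[ℝ] E →L[ℝ] ℝ) (U : Set E) : Prop where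
  isOpen : IsOpen U
  smooth : ContDiffOn ℝ ∞ G U
  symm : ∀ y ∈ U, ∀ v w, G y v w = G y w v
  pos : ∀ y ∈ U, ∀ v, v ≠ 0 → 0 < G y v v

variable {G : E → E →L[ℝ] E →L[ℝ] ℝ} {U : Set E} {y : E}

theorem IsMetricOn.contDiffAt (hG : IsMetricOn G U) (hy : y ∈ U) : ContDiffAt ℝ ∞ G y :=
  hG.smooth.contDiffAt (hG.isOpen.mem_nhds hy)

theorem IsMetricOn.differentiableAt (hG : IsMetricOn G U) (hy : y ∈ U) : DifferentiableAt ℝ G y :=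
  (hG.contDiffAt hy).differentiableAt (by simp)

theorem IsMetricOn.eq_of_forall (hG : IsMetricOn G U) (hy : y ∈ U) {a b : E}
    (h : ∀ z, G y a z = G y b z) : a = b := by
  by_contra hab
  have h1 := hG.pos y hy (a - b) (sub_ne_zero.2 hab)
  have h2 : G y (a - b) (a - b) = G y a (a - b) - G y b (a - b) := by
    rw [(G y).map_sub, sub_apply]
  rw [h2, h, sub_self] at h1
  exact lt_irrefl _ h1

theorem fderiv_apply₂ {G : E → F →L[ℝ] F →L[ℝ] ℝ} {y : E} (hG : DifferentiableAt ℝ G y) (v : E)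
    (a b : F) : fderiv ℝ (fun z => G z a b) y v = fderiv ℝ G y v a b := by
  have h := (hG.hasFDerivAt.clm_apply (hasFDerivAt_const a y)).clm_apply (hasFDerivAt_const b y)
  rw [h.fderiv]
  simp

theorem IsMetricOn.fderiv_symm (hG : IsMetricOn G U) (hy : y ∈ U) (v a b : E) :
    fderiv ℝ G y v a b = fderiv ℝ G y v b a := by
  rw [← fderiv_apply₂ (hG.differentiableAt hy), ← fderiv_apply₂ (hG.differentiableAt hy)]
  congr 1
  refine EventuallyEq.fderiv_eq ?_
  filter_upwards [hG.isOpen.mem_nhds hy] with z hz using hG.symm z hz a b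

/-- Positivity gives injectivity into the dual, which has the same dimension. Hence
`ContinuousLinearMap.inverse` is the true inverse here and not its default value `0`. -/
theorem isInvertible_of_pos [FiniteDimensional ℝ E] {B : E →L[ℝ] E →L[ℝ] ℝ}
    (hB : ∀ v, v ≠ 0 → 0 < B v v) : B.IsInvertible := by
  have hinj : Function.Injective B := by
    rw [injective_iff_map_eq_zero]
    intro v hv
    by_contra h
    have := hB v h
    simp [hv] at this
  have hrank : Module.finrank ℝ E = Module.finrank ℝ (E →L[ℝ] ℝ) := by
    rw [← (LinearMap.toContinuousLinearMap : (E →ₗ[ℝ] ℝ) ≃ₗ[ℝ] E →L[ℝ] ℝ).finrank_eq]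
    exact (Subspace.dual_finrank_eq (K := ℝ) (V := E)).symm
  let e := LinearEquiv.ofInjectiveOfFinrankEq (B : E →ₗ[ℝ] E →L[ℝ] ℝ) hinj hrank
  exact ⟨e.toContinuousLinearEquiv, by ext v; rfl⟩

theorem IsMetricOn.isInvertible [FiniteDimensional ℝ E] (hG : IsMetricOn G U) (hy : y ∈ U) :
    (G y).IsInvertible :=
  isInvertible_of_pos (hG.pos y hy)

theorem apply_inverse_apply {B : E →L[ℝ] E →L[ℝ] ℝ} (hB : B.IsInvertible) (l : E →L[ℝ] ℝ) :
    B (B.inverse l) = l := by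
  obtain ⟨e, rfl⟩ := hB
  simp

variable [FiniteDimensional ℝ E]

theorem IsMetricOn.apply_christoffel (hG : IsMetricOn G U) (hy : y ∈ U) (v w z : E) :
    G y (christoffel G y v w) z = koszul G y v w z := by
  rw [christoffel_apply, apply_inverse_apply (hG.isInvertible hy)]

theorem IsMetricOn.christoffel_symm (hG : IsMetricOn G U) (hy : y ∈ U) (v w : E) :
    christoffel G y v w = christoffel G y w v := by
  refine hG.eq_of_forall hy fun z => ?_
  rw [hG.apply_christoffel hy, hG.apply_christoffel hy, koszul_apply, koszul_apply,
    hG.fderiv_symm hy z v w]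
  ring

/-- The Levi-Civita connection is compatible with the metric. -/
theorem IsMetricOn.fderiv_apply (hG : IsMetricOn G U) (hy : y ∈ U) (v w z : E) :
    fderiv ℝ G y v w z = G y (christoffel G y v w) z + G y w (christoffel G y v z) := by
  rw [hG.symm y hy w, hG.apply_christoffel hy, hG.apply_christoffel hy, koszul_apply, koszul_apply,
    hG.fderiv_symm hy z v w, hG.fderiv_symm hy w v z, hG.fderiv_symm hy v z w]
  ring

/-- A symmetric connection compatible with the metric is the Levi-Civita connection. -/
theorem IsMetricOn.christoffel_eq (hG : IsMetricOn G U) (hy : y ∈ U) {C : E → E → E}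
    (hC : ∀ v w, C v w = C w v)
    (hGC : ∀ v w z, fderiv ℝ G y v w z = G y (C v w) z + G y w (C v z)) (v w : E) :
    christoffel G y v w = C v w := by
  refine hG.eq_of_forall hy fun z => ?_
  -- Compatibility turns the Koszul expression into six terms; by the symmetry of `C` four of them
  -- cancel and the other two are equal.
  rw [hG.apply_christoffel hy, koszul_apply, hGC, hGC, hGC, hC w v, hC z v, hC z w,
    hG.symm y hy (C v z) w]
  ring

theorem IsMetricOn.contDiffAt_christoffel (hG : IsMetricOn G U) (hy : y ∈ U) :
    ContDiffAt ℝ ∞ (christoffel G) y := by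
  have hD : ContDiffAt ℝ ∞ (fderiv ℝ G) y := (hG.contDiffAt hy).fderiv_right (by simp)
  have hinv : ContDiffAt ℝ ∞ (fun z => (G z).inverse) y :=
    ((hG.isInvertible hy).contDiffAt_map_inverse).comp y (hG.contDiffAt hy)
  have hflip : ContDiffAt ℝ ∞ (fun z => (fderiv ℝ G z).flip) y :=
    (ContinuousLinearMap.flipₗᵢ ℝ E E (E →L[ℝ] ℝ)).toContinuousLinearEquiv.contDiff.contDiffAt.comp
      y hD
  have hK : ContDiffAt ℝ ∞ (koszul G) y := by
    unfold koszul
    exact ((hD.add hflip).sub (contDiffAt_const.clm_comp hflip)).const_smul _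
  unfold christoffel
  exact ((ContinuousLinearMap.compL ℝ E (E →L[ℝ] ℝ) E).contDiff.contDiffAt.comp y hinv).clm_comp hK

theorem IsMetricOn.differentiableAt_christoffel (hG : IsMetricOn G U) (hy : y ∈ U) :
    DifferentiableAt ℝ (christoffel G) y :=
  (hG.contDiffAt_christoffel hy).differentiableAt (by simp)

end MetricOn

/-! ### Traces in orthonormal frames -/

section Trace

variable {E : Type*} [NormedAddCommGroup E] [NormedSpace ℝ E] [FiniteDimensional ℝ E]
  {F : Type*} [NormedAddCommGroup F] [NormedSpace ℝ F]

/-- The trace computed in a frame `e` with `v = ∑ G(e_i, v) e_i`. -/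
theorem metricTrace_eq_sum {ι : Type*} [Fintype ι] {G : E →L[ℝ] E →L[ℝ] ℝ} (hG : G.IsInvertible)
    (hs : ∀ v w, G v w = G w v) {e : ι → E} (he : ∀ v, ∑ i, G (e i) v • e i = v)
    (B : E →ₗ[ℝ] E →ₗ[ℝ] F) : metricTrace G (fun v w => B v w) = ∑ i, B (e i) (e i) := by
  set b := Module.finBasis ℝ E
  -- This is `he` applied to `G⁻¹ l`, because `G (e i) (G⁻¹ l) = l (e i)`. Linear independence of
  -- `e` plays no role.
  have hinv : ∀ l : E →L[ℝ] ℝ, G.inverse l = ∑ i, l (e i) • e i := fun l => by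
    conv_lhs => rw [← he (G.inverse l)]
    refine Finset.sum_congr rfl fun i _ => ?_
    rw [hs, apply_inverse_apply hG]
  have hb : ∀ v, ∑ k, b.coord k v • b k = v := fun v => by simp [b.sum_repr v]
  calc metricTrace G (fun v w => B v w)
      = ∑ k, ∑ i, B (b.coord k (e i) • b k) (e i) := by
        unfold metricTrace
        refine Finset.sum_congr rfl fun k _ => ?_
        simp [hinv, b]
    _ = ∑ i, B (∑ k, b.coord k (e i) • b k) (e i) := by
        rw [Finset.sum_comm]
        simp only [map_sum, LinearMap.sum_apply]
    _ = ∑ i, B (e i) (e i) := by simp only [hb]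

/-- An orthogonal basis of the form is normalized by `1/√(G (v i) (v i))`; the reproducing formula
is then checked on the basis vectors. -/
theorem exists_orthonormal_frame {G : E →L[ℝ] E →L[ℝ] ℝ} (hs : ∀ v w, G v w = G w v)
    (hpos : ∀ v, v ≠ 0 → 0 < G v v) :
    ∃ e : Fin (Module.finrank ℝ E) → E, (∀ i, G (e i) (e i) = 1) ∧
      ∀ v, ∑ i, G (e i) v • e i = v := by
  let B : LinearMap.BilinForm ℝ E :=
    LinearMap.mk₂ ℝ (fun v w => G v w) (by simp) (by simp) (by simp) (by simp)
  have hB : ∀ v w, B v w = G v w := fun v w => rfl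
  obtain ⟨v, hv⟩ := LinearMap.BilinForm.exists_orthogonal_basis (B := B) ⟨fun a b => by
    simp [hB, hs a b]⟩
  have hp : ∀ i, 0 < G (v i) (v i) := fun i => hpos _ (v.ne_zero i)
  have hsq : ∀ i, (√(G (v i) (v i)))⁻¹ * (√(G (v i) (v i)))⁻¹ = (G (v i) (v i))⁻¹ := fun i => by
    rw [← mul_inv, Real.mul_self_sqrt (hp i).le]
  refine ⟨fun i => (√(G (v i) (v i)))⁻¹ • v i, fun i => ?_, fun w => ?_⟩
  · simp only [map_smul, smul_apply, smul_eq_mul]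
    rw [← mul_assoc, hsq, inv_mul_cancel₀ (hp i).ne']
  · let S : E →ₗ[ℝ] E := ∑ i, (G ((√(G (v i) (v i)))⁻¹ • v i) : E →ₗ[ℝ] ℝ).smulRight
      ((√(G (v i) (v i)))⁻¹ • v i)
    have hS : S = LinearMap.id := by
      refine v.ext fun j => ?_
      simp only [S, LinearMap.sum_apply, LinearMap.smulRight_apply, LinearMap.id_apply]
      rw [Finset.sum_eq_single j]
      · simp only [map_smul, ContinuousLinearMap.coe_coe, smul_apply, smul_eq_mul, smul_smul]
        rw [mul_right_comm, hsq, inv_mul_cancel₀ (hp j).ne', one_smul]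
      · intro i _ hij
        have h0 : G (v i) (v j) = 0 := hv hij
        simp [h0]
      · simp
    have := LinearMap.congr_fun hS w
    simpa [S] using this

end Trace

/-! ### Covariant derivatives and curvature for the identity map -/

section Connection

variable {E : Type*} [NormedAddCommGroup E] [NormedSpace ℝ E]
  {F : Type*} [NormedAddCommGroup F] [NormedSpace ℝ F]

theorem pullbackCov_id (G : E → E →L[ℝ] E →L[ℝ] ℝ) (V : E → E) (y v : E) :
    pullbackCov G id V y v = fderiv ℝ V y v + christoffel G y v (V y) := by
  simp [pullbackCov]

theorem pullbackCov_id_congr (G : E → E →L[ℝ] E →L[ℝ] ℝ) {V W : E → E} {y : E}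
    (h : V =ᶠ[𝓝 y] W) (v : E) : pullbackCov G id V y v = pullbackCov G id W y v := by
  rw [pullbackCov_id, pullbackCov_id, h.fderiv_eq, h.eq_of_nhds]

variable {G : E → E →L[ℝ] E →L[ℝ] ℝ} {V : E → E} {y : E}

theorem contDiffAt_pullbackCov_id (hG : ContDiffAt ℝ ∞ (christoffel G) y)
    (hV : ContDiffAt ℝ ∞ V y) (v : E) :
    ContDiffAt ℝ ∞ (fun z => pullbackCov G id V z v) y := by
  simp only [pullbackCov_id]
  have hD : ContDiffAt ℝ ∞ (fderiv ℝ V) y := hV.fderiv_right (by simp)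
  exact (hD.clm_apply contDiffAt_const).add ((hG.clm_apply contDiffAt_const).clm_apply hV)

/-- The derivative of `∇_v V` for a constant vector `v`. -/
theorem fderiv_pullbackCov_id (hG : ContDiffAt ℝ ∞ (christoffel G) y)
    (hV : ContDiffAt ℝ ∞ V y) (u v : E) :
    fderiv ℝ (fun z => pullbackCov G id V z v) y u =
      fderiv ℝ (fderiv ℝ V) y u v + fderiv ℝ (christoffel G) y u v (V y)
        + christoffel G y v (fderiv ℝ V y u) := by
  simp only [pullbackCov_id]
  have hD : ContDiffAt ℝ ∞ (fderiv ℝ V) y := hV.fderiv_right (by simp)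
  have h1 := (hD.differentiableAt (by simp)).hasFDerivAt.clm_apply (hasFDerivAt_const v y)
  have h2 := ((hG.differentiableAt (by simp)).hasFDerivAt.clm_apply
    (hasFDerivAt_const v y)).clm_apply (hV.differentiableAt (by simp)).hasFDerivAt
  rw [HasFDerivAt.fderiv (h1.fun_add h2)]
  simp only [add_apply, ContinuousLinearMap.comp_apply, ContinuousLinearMap.flip_apply, zero_apply,
    map_zero, zero_add]
  abel

theorem curvature_eq (hG : DifferentiableAt ℝ (christoffel G) y) (u v w : E) :
    curvature G y u v w = fderiv ℝ (christoffel G) y u v w - fderiv ℝ (christoffel G) y v u w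
      + christoffel G y u (christoffel G y v w) - christoffel G y v (christoffel G y u w) := by
  have h : ∀ u v, fderiv ℝ (fun z => christoffel G z v w) y u =
      fderiv ℝ (christoffel G) y u v w := fun u v => by
    rw [HasFDerivAt.fderiv ((hG.hasFDerivAt.clm_apply (hasFDerivAt_const v y)).clm_apply
      (hasFDerivAt_const w y))]
    simp
  rw [curvature, h, h]

/-- The Ricci identity for constant vectors `u` and `v`. -/
theorem ricci_identity (hG : ContDiffAt ℝ ∞ (christoffel G) y) (hV : ContDiffAt ℝ ∞ V y)
    (u v : E) :
    pullbackCov G id (fun z => pullbackCov G id V z v) y u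
      - pullbackCov G id (fun z => pullbackCov G id V z u) y v = curvature G y u v (V y) := by
  -- The second derivatives of `V` cancel in the commutator, and so do the first ones; only
  -- curvature is left.
  have hsymm : fderiv ℝ (fderiv ℝ V) y u v = fderiv ℝ (fderiv ℝ V) y v u :=
    (hV.isSymmSndFDerivAt (by
      simp only [minSmoothness_of_isRCLikeNormedField]
      exact WithTop.coe_le_coe.2 le_top)).eq u v
  rw [pullbackCov_id G (fun z => pullbackCov G id V z v),
    pullbackCov_id G (fun z => pullbackCov G id V z u), fderiv_pullbackCov_id hG hV,
    fderiv_pullbackCov_id hG hV, curvature_eq (hG.differentiableAt (by simp)), pullbackCov_id,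
    pullbackCov_id, hsymm]
  simp only [map_add]
  abel

/-- The curvature as a bilinear map of its last two arguments. -/
theorem exists_curvature_bilin (hG : DifferentiableAt ℝ (christoffel G) y) (u : E) :
    ∃ B : E →ₗ[ℝ] E →ₗ[ℝ] E, ∀ v w, curvature G y u v w = B v w := by
  refine ⟨LinearMap.mk₂ ℝ (curvature G y u) ?_ ?_ ?_ ?_, fun v w => rfl⟩
  · intro v v' w
    simp only [curvature_eq hG, map_add, add_apply]
    abel
  · intro c v w
    simp only [curvature_eq hG, map_smul, smul_apply, smul_sub, smul_add]
  · intro v w w'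
    simp only [curvature_eq hG, map_add]
    abel
  · intro c v w
    simp only [curvature_eq hG, map_smul, smul_sub, smul_add]

/-- Bilinearity in the two directions is what allows the trace to be taken in an adapted frame
instead of the fixed basis. -/
theorem exists_secondCov_bilin {GM : E → E →L[ℝ] E →L[ℝ] ℝ}
    (hG : ContDiffAt ℝ ∞ (christoffel G) y) (hV : ContDiffAt ℝ ∞ V y) :
    ∃ B : E →ₗ[ℝ] E →ₗ[ℝ] E, ∀ v w, secondCov GM G id V y v w = B v w := by
  have h : ∀ v w, secondCov GM G id V y v w =
      fderiv ℝ (fderiv ℝ V) y v w + fderiv ℝ (christoffel G) y v w (V y)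
        + christoffel G y w (fderiv ℝ V y v)
        + christoffel G y v (fderiv ℝ V y w + christoffel G y w (V y))
        - (fderiv ℝ V y (christoffel GM y v w)
            + christoffel G y (christoffel GM y v w) (V y)) := fun v w => by
    rw [secondCov, pullbackCov_id, fderiv_pullbackCov_id hG hV, pullbackCov_id, pullbackCov_id]
  refine ⟨LinearMap.mk₂ ℝ (secondCov GM G id V y) ?_ ?_ ?_ ?_, fun v w => rfl⟩
  · intro v v' w
    simp only [h, map_add, add_apply]
    abel
  · intro c v w
    simp only [h, map_smul, map_add, smul_apply, smul_sub, smul_add]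
  · intro v w w'
    simp only [h, map_add, add_apply]
    abel
  · intro c v w
    simp only [h, map_smul, map_add, smul_apply, smul_sub, smul_add]

theorem traceSecondCov_const_smul [FiniteDimensional ℝ E] {GM : E → E →L[ℝ] E →L[ℝ] ℝ}
    (hV : ∀ᶠ z in 𝓝 y, DifferentiableAt ℝ V z)
    (hV' : ∀ v, DifferentiableAt ℝ (fun z => pullbackCov G id V z v) y) (c : ℝ) :
    traceSecondCov GM G id (fun z => c • V z) y = c • traceSecondCov GM G id V y := by
  have h1 : ∀ z, DifferentiableAt ℝ V z → ∀ v,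
      pullbackCov G id (fun z => c • V z) z v = c • pullbackCov G id V z v := fun z hz v => by
    rw [pullbackCov_id, pullbackCov_id, fderiv_fun_const_smul hz]
    simp
  have h2 : ∀ v w, secondCov GM G id (fun z => c • V z) y v w = c • secondCov GM G id V y v w := by
    intro v w
    rw [secondCov, secondCov, h1 y hV.self_of_nhds, smul_sub]
    congr 1
    rw [pullbackCov_id_congr G (W := fun z => c • pullbackCov G id V z w)
      (hV.mono fun z hz => h1 z hz w)]
    rw [pullbackCov_id G (fun z => c • pullbackCov G id V z w),
      pullbackCov_id G (fun z => pullbackCov G id V z w), fderiv_fun_const_smul (hV' w)]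
    simp only [smul_apply, map_smul, smul_add]
  simp only [traceSecondCov, metricTrace, h2, Finset.smul_sum]

end Connection

/-! ### Dependence on germs only -/

section Congruence

variable {E : Type*} [NormedAddCommGroup E] [NormedSpace ℝ E]
  {F : Type*} [NormedAddCommGroup F] [NormedSpace ℝ F]

/-- Chart expressions agree with the model formulas only near a point. Agreement near `y` gives
agreement near every point close to `y`, so the conclusion is again about germs and can be
differentiated further. -/
theorem christoffel_congr {G G' : E → E →L[ℝ] E →L[ℝ] ℝ} {y : E} (h : G =ᶠ[𝓝 y] G') :
    christoffel G =ᶠ[𝓝 y] christoffel G' := by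
  filter_upwards [h.eventuallyEq_nhds] with z hz
  unfold christoffel koszul
  rw [hz.fderiv_eq, hz.eq_of_nhds]

theorem curvature_congr {G G' : E → E →L[ℝ] E →L[ℝ] ℝ} {y : E} (h : G =ᶠ[𝓝 y] G') (u v w : E) :
    curvature G y u v w = curvature G' y u v w := by
  have hc := christoffel_congr h
  have h' : ∀ a b, (fun z => christoffel G z a b) =ᶠ[𝓝 y] fun z => christoffel G' z a b :=
    fun a b => hc.mono fun z hz => by simp only [hz]
  unfold curvature
  rw [hc.eq_of_nhds, (h' v w).fderiv_eq, (h' u w).fderiv_eq]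

theorem pullbackCov_congr {G G' : F → F →L[ℝ] F →L[ℝ] ℝ} {φ φ' V V' : E → F} {y : E}
    (hG : G =ᶠ[𝓝 (φ y)] G') (hφ : φ =ᶠ[𝓝 y] φ') (hV : V =ᶠ[𝓝 y] V') (v : E) :
    pullbackCov G φ V y v = pullbackCov G' φ' V' y v := by
  unfold pullbackCov
  rw [hV.fderiv_eq, hφ.fderiv_eq, hV.eq_of_nhds, ← hφ.eq_of_nhds, (christoffel_congr hG).eq_of_nhds]

variable [FiniteDimensional ℝ E] {GM GM' : E → E →L[ℝ] E →L[ℝ] ℝ}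
  {GN GN' : F → F →L[ℝ] F →L[ℝ] ℝ} {φ φ' V V' : E → F} {y : E}

theorem localTension_congr (hM : GM =ᶠ[𝓝 y] GM') (hN : GN =ᶠ[𝓝 (φ y)] GN')
    (hφ : φ =ᶠ[𝓝 y] φ') : localTension GM GN φ y = localTension GM' GN' φ' y := by
  have h : secondFundForm GM GN φ y = secondFundForm GM' GN' φ' y := by
    funext v w
    unfold secondFundForm
    rw [pullbackCov_congr hN hφ (hφ.fderiv.mono fun z hz => by rw [hz]), hφ.fderiv_eq,
      (christoffel_congr hM).eq_of_nhds]
  rw [localTension, localTension, h, hM.eq_of_nhds]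

theorem traceSecondCov_congr (hM : GM =ᶠ[𝓝 y] GM') (hN : GN =ᶠ[𝓝 (φ y)] GN')
    (hφ : φ =ᶠ[𝓝 y] φ') (hc : ContinuousAt φ y) (hV : V =ᶠ[𝓝 y] V') :
    traceSecondCov GM GN φ V y = traceSecondCov GM' GN' φ' V' y := by
  have h : secondCov GM GN φ V y = secondCov GM' GN' φ' V' y := by
    funext v w
    unfold secondCov
    rw [pullbackCov_congr hN hφ hV, (christoffel_congr hM).eq_of_nhds]
    rw [pullbackCov_congr hN hφ]
    filter_upwards [hc.eventually hN.eventuallyEq_nhds, hφ.eventuallyEq_nhds,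
      hV.eventuallyEq_nhds] with z h1 h2 h3 using pullbackCov_congr h1 h2 h3 w
  rw [traceSecondCov, traceSecondCov, h, hM.eq_of_nhds]

theorem localBitension_congr (hM : GM =ᶠ[𝓝 y] GM') (hN : GN =ᶠ[𝓝 (φ y)] GN')
    (hφ : φ =ᶠ[𝓝 y] φ') (hc : ContinuousAt φ y) :
    localBitension GM GN φ y = localBitension GM' GN' φ' y := by
  have hτ : localTension GM GN φ =ᶠ[𝓝 y] localTension GM' GN' φ' := by
    filter_upwards [hM.eventuallyEq_nhds, hc.eventually hN.eventuallyEq_nhds,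
      hφ.eventuallyEq_nhds] with z h1 h2 h3 using localTension_congr h1 h2 h3
  unfold localBitension
  rw [traceSecondCov_congr hM hN hφ hc hτ, hM.eq_of_nhds, hτ.eq_of_nhds, hφ.fderiv_eq]
  simp only [curvature_congr hN, ← hφ.eq_of_nhds]

end Congruence

/-! ### The Mus-Sasaki metric in coordinates and its connection -/

section BundleMetric

variable {E : Type*} [NormedAddCommGroup E] [NormedSpace ℝ E]

/-- The vertical component `b + Γ(a, y)` of a tangent vector `(a, b)` at `z = (x, y)`. -/
def vertForm (G : E → E →L[ℝ] E →L[ℝ] ℝ) (z : E × E) : E × E →L[ℝ] E :=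
  ContinuousLinearMap.snd ℝ E E +
    ((christoffel G z.1).flip z.2).comp (ContinuousLinearMap.fst ℝ E E)

/-- The coordinate expression of the Mus-Sasaki metric. -/
def bundleMetric (G : E → E →L[ℝ] E →L[ℝ] ℝ) (f : E → ℝ) (z : E × E) :
    E × E →L[ℝ] E × E →L[ℝ] ℝ :=
  pullForm (G z.1) (ContinuousLinearMap.fst ℝ E E) + f z.1 • pullForm (G z.1) (vertForm G z)

/-- The coordinate expression of the gradient. -/
def localGrad (G : E → E →L[ℝ] E →L[ℝ] ℝ) (f : E → ℝ) (y : E) : E :=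
  (G y).inverse (fderiv ℝ f y)

/-- The vector at `z` with horizontal component `a` and vertical component `c`. -/
def liftVec (G : E → E →L[ℝ] E →L[ℝ] ℝ) (z : E × E) (a c : E) : E × E :=
  (a, c - christoffel G z.1 a z.2)

variable {G : E → E →L[ℝ] E →L[ℝ] ℝ} {U : Set E} {f : E → ℝ} {z : E × E}

theorem vertForm_apply (G : E → E →L[ℝ] E →L[ℝ] ℝ) (z v : E × E) :
    vertForm G z v = v.2 + christoffel G z.1 v.1 z.2 := rfl

theorem bundleMetric_apply (G : E → E →L[ℝ] E →L[ℝ] ℝ) (f : E → ℝ) (z v w : E × E) :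
    bundleMetric G f z v w = G z.1 v.1 w.1 + f z.1 * G z.1 (vertForm G z v) (vertForm G z w) := rfl

@[simp] theorem liftVec_fst (z : E × E) (a c : E) : (liftVec G z a c).1 = a := rfl

@[simp] theorem vertForm_liftVec (z : E × E) (a c : E) : vertForm G z (liftVec G z a c) = c := by
  simp [vertForm_apply, liftVec]

theorem liftVec_zero_left (z : E × E) (c : E) : liftVec G z 0 c = (0, c) := by
  simp [liftVec]

theorem vertForm_zero_left (z : E × E) (c : E) : vertForm G z (0, c) = c := by
  simp [vertForm_apply]

/-- Identities in `T(TM)` are checked below on horizontal and vertical components separately. -/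
theorem vertForm_ext {v w : E × E} (h1 : v.1 = w.1) (h2 : vertForm G z v = vertForm G z w) :
    v = w := by
  refine Prod.ext h1 ?_
  rw [vertForm_apply, vertForm_apply, h1] at h2
  exact add_right_cancel h2

theorem fderiv_comp_fst {F : Type*} [NormedAddCommGroup F] [NormedSpace ℝ F] {h : E → F}
    (hh : DifferentiableAt ℝ h z.1) (v : E × E) :
    fderiv ℝ (fun w : E × E => h w.1) z v = fderiv ℝ h z.1 v.1 := by
  have := hh.hasFDerivAt.comp z (hasFDerivAt_fst (𝕜 := ℝ) (p := z))
  rw [HasFDerivAt.fderiv (f := fun w : E × E => h w.1) this]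
  rfl

variable [FiniteDimensional ℝ E]

theorem IsMetricOn.contDiffAt_vertForm (hG : IsMetricOn G U) (hz : z.1 ∈ U) :
    ContDiffAt ℝ ∞ (vertForm G) z := by
  have h1 : ContDiffAt ℝ ∞ (fun z : E × E => (christoffel G z.1).flip) z :=
    (ContinuousLinearMap.flipₗᵢ ℝ E E E).toContinuousLinearEquiv.contDiff.contDiffAt.comp z
      ((hG.contDiffAt_christoffel hz).comp z contDiffAt_fst)
  exact contDiffAt_const.add ((h1.clm_apply contDiffAt_snd).clm_comp contDiffAt_const)

theorem IsMetricOn.differentiableAt_vertForm (hG : IsMetricOn G U) (hz : z.1 ∈ U) :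
    DifferentiableAt ℝ (vertForm G) z :=
  (hG.contDiffAt_vertForm hz).differentiableAt (by simp)

theorem IsMetricOn.fderiv_vertForm (hG : IsMetricOn G U) (hz : z.1 ∈ U) (v w : E × E) :
    fderiv ℝ (vertForm G) z v w =
      fderiv ℝ (christoffel G) z.1 v.1 w.1 z.2 + christoffel G z.1 w.1 v.2 := by
  have h1 : fderiv ℝ (fun x => vertForm G x w) z v = fderiv ℝ (vertForm G) z v w := by
    rw [HasFDerivAt.fderiv ((hG.differentiableAt_vertForm hz).hasFDerivAt.clm_apply
      (hasFDerivAt_const w z))]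
    simp
  have h2 : HasFDerivAt (fun x : E × E => christoffel G x.1)
      ((fderiv ℝ (christoffel G) z.1).comp (ContinuousLinearMap.fst ℝ E E)) z :=
    (hG.differentiableAt_christoffel hz).hasFDerivAt.comp z (hasFDerivAt_fst (𝕜 := ℝ) (p := z))
  have h3 := ((h2.clm_apply (hasFDerivAt_const w.1 z)).clm_apply
    (hasFDerivAt_snd (𝕜 := ℝ) (p := z))).const_add w.2
  rw [← h1, HasFDerivAt.fderiv (f := fun x => vertForm G x w) h3]
  simp [add_comm]

/-- The torsion of the adapted frame vanishes up to the connection, as `G` is flat. -/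
theorem IsMetricOn.fderiv_vertForm_sub (hG : IsMetricOn G U)
    (hflat : ∀ y ∈ U, ∀ u v w, curvature G y u v w = 0) (hz : z.1 ∈ U) (v w : E × E) :
    fderiv ℝ (vertForm G) z v w - fderiv ℝ (vertForm G) z w v =
      christoffel G z.1 w.1 (vertForm G z v) - christoffel G z.1 v.1 (vertForm G z w) := by
  -- The two sides of the goal differ exactly by `R(v.1, w.1) z.2`.
  have h := hflat z.1 hz v.1 w.1 z.2
  rw [curvature_eq (hG.differentiableAt_christoffel hz)] at h
  rw [hG.fderiv_vertForm hz, hG.fderiv_vertForm hz, vertForm_apply, vertForm_apply, map_add,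
    map_add, ← sub_eq_zero, ← h]
  abel

theorem IsMetricOn.bundleMetric (hG : IsMetricOn G U) (hf : ContDiffOn ℝ ∞ f U)
    (hpos : ∀ y ∈ U, 0 < f y) : IsMetricOn (bundleMetric G f) (Prod.fst ⁻¹' U) where
  isOpen := hG.isOpen.preimage continuous_fst
  smooth := by
    intro z hz
    refine ContDiffAt.contDiffWithinAt ?_
    have hg : ContDiffAt ℝ ∞ (fun z : E × E => G z.1) z := (hG.contDiffAt hz).comp z contDiffAt_fst
    have hf' : ContDiffAt ℝ ∞ (fun z : E × E => f z.1) z :=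
      (hf.contDiffAt (hG.isOpen.mem_nhds hz)).comp z contDiffAt_fst
    have hv := hG.contDiffAt_vertForm hz
    have hpre : ContDiffAt ℝ ∞ (fun z : E × E => (vertForm G z).precomp ℝ) z :=
      ((ContinuousLinearMap.compL ℝ (E × E) E ℝ).flip).contDiff.contDiffAt.comp z hv
    exact (contDiffAt_const.clm_comp (hg.clm_comp contDiffAt_const)).add
      (hf'.smul (hpre.clm_comp (hg.clm_comp hv)))
  symm := by
    intro z hz v w
    rw [bundleMetric_apply, bundleMetric_apply, hG.symm z.1 hz v.1,
      hG.symm z.1 hz (vertForm G z v)]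
  pos := by
    intro z hz v hv
    rw [bundleMetric_apply]
    by_cases h1 : v.1 = 0
    · have h2 : vertForm G z v ≠ 0 := fun h2 => hv (vertForm_ext (z := z) (G := G)
        (by simpa using h1) (by simpa using h2))
      rw [h1, map_zero, zero_add]
      exact mul_pos (hpos _ hz) (hG.pos _ hz _ h2)
    · refine add_pos_of_pos_of_nonneg (hG.pos _ hz _ h1) (mul_nonneg (hpos _ hz).le ?_)
      by_cases h2 : vertForm G z v = 0
      · simp [h2]
      · exact (hG.pos _ hz _ h2).le

theorem IsMetricOn.fderiv_bundleMetric (hG : IsMetricOn G U) (hf : ContDiffOn ℝ ∞ f U)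
    (hpos : ∀ y ∈ U, 0 < f y) (hz : z.1 ∈ U) (u v w : E × E) :
    fderiv ℝ (MusSasaki.bundleMetric G f) z u v w = fderiv ℝ G z.1 u.1 v.1 w.1
      + fderiv ℝ f z.1 u.1 * G z.1 (vertForm G z v) (vertForm G z w)
      + f z.1 * (fderiv ℝ G z.1 u.1 (vertForm G z v) (vertForm G z w)
        + G z.1 (fderiv ℝ (vertForm G) z u v) (vertForm G z w)
        + G z.1 (vertForm G z v) (fderiv ℝ (vertForm G) z u w)) := by
  have hfst := hasFDerivAt_fst (𝕜 := ℝ) (p := z)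
  have h0 : HasFDerivAt (fun x : E × E => G x.1)
      ((fderiv ℝ G z.1).comp (ContinuousLinearMap.fst ℝ E E)) z :=
    (hG.differentiableAt hz).hasFDerivAt.comp z hfst
  have h1 : HasFDerivAt (fun x : E × E => f x.1)
      ((fderiv ℝ f z.1).comp (ContinuousLinearMap.fst ℝ E E)) z :=
    ((hf.contDiffAt (hG.isOpen.mem_nhds hz)).differentiableAt (by simp)).hasFDerivAt.comp z hfst
  have h2 : ∀ v, HasFDerivAt (fun x : E × E => vertForm G x v)
      ((fderiv ℝ (vertForm G) z).flip v) z := fun v => by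
    simpa using (hG.differentiableAt_vertForm hz).hasFDerivAt.clm_apply (hasFDerivAt_const v z)
  have h3 := ((h0.clm_apply (hasFDerivAt_const v.1 z)).clm_apply (hasFDerivAt_const w.1 z)).fun_add
    (h1.fun_mul ((h0.clm_apply (h2 v)).clm_apply (h2 w)))
  rw [← fderiv_apply₂ ((hG.bundleMetric hf hpos).differentiableAt hz),
    HasFDerivAt.fderiv (f := fun x => MusSasaki.bundleMetric G f x v w) h3]
  simp
  ring

theorem IsMetricOn.apply_localGrad (hG : IsMetricOn G U) {y : E} (hy : y ∈ U) (v : E) :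
    G y (localGrad G f y) v = fderiv ℝ f y v := by
  rw [localGrad, apply_inverse_apply (hG.isInvertible hy)]

/-- The Levi-Civita connection of the Mus-Sasaki metric of a flat metric. -/
theorem IsMetricOn.christoffel_bundleMetric (hG : IsMetricOn G U)
    (hflat : ∀ y ∈ U, ∀ u v w, curvature G y u v w = 0) (hf : ContDiffOn ℝ ∞ f U)
    (hpos : ∀ y ∈ U, 0 < f y) (hz : z.1 ∈ U) (v w : E × E) :
    christoffel (MusSasaki.bundleMetric G f) z v w = liftVec G z
      (christoffel G z.1 v.1 w.1
        - ((1 / 2) * G z.1 (vertForm G z v) (vertForm G z w)) • localGrad G f z.1)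
      (fderiv ℝ (vertForm G) z v w + christoffel G z.1 v.1 (vertForm G z w)
        + (1 / (2 * f z.1)) • (fderiv ℝ f z.1 v.1 • vertForm G z w
          + fderiv ℝ f z.1 w.1 • vertForm G z v)) := by
  -- By uniqueness of the Levi-Civita connection it suffices to check symmetry and compatibility.
  -- Flatness enters only in the symmetry.
  refine (hG.bundleMetric hf hpos).christoffel_eq hz (C := fun v w => liftVec G z
      (christoffel G z.1 v.1 w.1
        - ((1 / 2) * G z.1 (vertForm G z v) (vertForm G z w)) • localGrad G f z.1)
      (fderiv ℝ (vertForm G) z v w + christoffel G z.1 v.1 (vertForm G z w)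
        + (1 / (2 * f z.1)) • (fderiv ℝ f z.1 v.1 • vertForm G z w
          + fderiv ℝ f z.1 w.1 • vertForm G z v))) ?_ ?_ v w
  · intro v w
    have h := hG.fderiv_vertForm_sub hflat hz v w
    rw [hG.christoffel_symm hz v.1 w.1, hG.symm _ hz (vertForm G z v),
      add_comm (fderiv ℝ f z.1 v.1 • vertForm G z w)]
    congr 2
    rw [sub_eq_sub_iff_add_eq_add] at h
    rw [h, add_comm]
  · intro u v w
    have hne : f z.1 ≠ 0 := (hpos _ hz).ne'
    have hs := hG.symm _ hz
    rw [hG.fderiv_bundleMetric hf hpos hz, bundleMetric_apply, bundleMetric_apply]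
    simp only [liftVec_fst, vertForm_liftVec, hG.fderiv_apply hz, map_add, map_sub, map_smul,
      add_apply, sub_apply, smul_apply, smul_eq_mul, hG.apply_localGrad hz]
    rw [hs v.1 (localGrad G f z.1), hG.apply_localGrad hz, hs (vertForm G z v) (vertForm G z u)]
    field_simp
    ring

end BundleMetric

/-! ### Covariant derivatives and curvature in the adapted frame -/

section BundleConnection

variable {E : Type*} [NormedAddCommGroup E] [NormedSpace ℝ E]

/-- `G` is a flat metric and `f` a positive function, both smooth on the open set `U`. -/
structure IsFlatWeighted (G : E → E →L[ℝ] E →L[ℝ] ℝ) (f : E → ℝ) (U : Set E) : Prop where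
  metric : IsMetricOn G U
  flat : ∀ y ∈ U, ∀ u v w, curvature G y u v w = 0
  smooth : ContDiffOn ℝ ∞ f U
  pos : ∀ y ∈ U, 0 < f y

variable {G : E → E →L[ℝ] E →L[ℝ] ℝ} {U : Set E} {f : E → ℝ} {z : E × E}

/-- The weight `1` gives the Sasaki metric, so each formula for the Mus-Sasaki metric also serves
the domain. -/
theorem IsFlatWeighted.one (h : IsFlatWeighted G f U) : IsFlatWeighted G (fun _ => 1) U :=
  ⟨h.metric, h.flat, contDiffOn_const, fun _ _ => one_pos⟩

theorem IsFlatWeighted.contDiffAt (h : IsFlatWeighted G f U) {y : E} (hy : y ∈ U) :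
    ContDiffAt ℝ ∞ f y :=
  h.smooth.contDiffAt (h.metric.isOpen.mem_nhds hy)

theorem localGrad_const (c : ℝ) (y : E) : localGrad G (fun _ => c) y = 0 := by
  simp [localGrad]

theorem liftVec_sub (z : E × E) (a a' c c' : E) :
    liftVec G z a c - liftVec G z a' c' = liftVec G z (a - a') (c - c') := by
  refine Prod.ext rfl ?_
  simp only [liftVec, Prod.snd_sub, map_sub, sub_apply]
  abel

theorem liftVec_add (z : E × E) (a a' c c' : E) :
    liftVec G z a c + liftVec G z a' c' = liftVec G z (a + a') (c + c') := by
  refine Prod.ext rfl ?_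
  simp only [liftVec, Prod.snd_add, map_add, add_apply]
  abel

theorem liftVec_smul (z : E × E) (r : ℝ) (a c : E) :
    r • liftVec G z a c = liftVec G z (r • a) (r • c) := by
  refine Prod.ext rfl ?_
  simp only [liftVec, Prod.smul_snd, map_smul, smul_apply, smul_sub]

theorem liftVec_zero (z : E × E) : liftVec G z 0 0 = 0 := by
  simp [liftVec]

theorem liftVec_eq_zero_iff (z : E × E) (a : E) : liftVec G z a 0 = 0 ↔ a = 0 :=
  ⟨fun h => congrArg Prod.fst h, fun h => by rw [h, liftVec_zero]⟩

theorem liftVec_sum {ι : Type*} (s : Finset ι) (z : E × E) (a : ι → E) :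
    ∑ i ∈ s, liftVec G z (a i) 0 = liftVec G z (∑ i ∈ s, a i) 0 := by
  classical
  induction s using Finset.induction_on with
  | empty => simp [liftVec_zero]
  | insert i s hi ih => rw [Finset.sum_insert hi, Finset.sum_insert hi, ih, liftVec_add, add_zero]

/-- The function `df(T)/(2f)` is the factor of the vertical part of the derivative of `T^H`, and
second derivatives of `T^H` differentiate it. -/
theorem IsFlatWeighted.contDiffAt_coeff (h : IsFlatWeighted G f U) {T : E → E} {y : E} (hy : y ∈ U)
    (hT : ContDiffAt ℝ ∞ T y) :
    ContDiffAt ℝ ∞ (fun y => 1 / (2 * f y) * fderiv ℝ f y (T y)) y := by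
  have hf := h.contDiffAt hy
  have hD : ContDiffAt ℝ ∞ (fderiv ℝ f) y := hf.fderiv_right (by simp)
  exact (contDiffAt_const.div (contDiffAt_const.mul hf)
    (mul_ne_zero two_ne_zero (h.pos y hy).ne')).mul (hD.clm_apply hT)

variable [FiniteDimensional ℝ E]

theorem IsMetricOn.contDiffAt_localGrad (hG : IsMetricOn G U) {y : E} (hy : y ∈ U)
    (hf : ContDiffAt ℝ ∞ f y) : ContDiffAt ℝ ∞ (localGrad G f) y :=
  (((hG.isInvertible hy).contDiffAt_map_inverse).comp y (hG.contDiffAt hy)).clm_apply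
    (hf.fderiv_right (by simp))

theorem IsMetricOn.contDiffAt_liftVec (hG : IsMetricOn G U) (hz : z.1 ∈ U) {A C : E × E → E}
    (hA : ContDiffAt ℝ ∞ A z) (hC : ContDiffAt ℝ ∞ C z) :
    ContDiffAt ℝ ∞ (fun x => liftVec G x (A x) (C x)) z :=
  hA.prodMk (hC.sub (((((hG.contDiffAt_christoffel hz).comp z contDiffAt_fst).clm_apply
    hA).clm_apply contDiffAt_snd)))

/-- The covariant derivative in the adapted frame. -/
theorem IsFlatWeighted.pullbackCov_liftVec (h : IsFlatWeighted G f U) (hz : z.1 ∈ U)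
    {A C : E × E → E} (hA : DifferentiableAt ℝ A z) (hC : DifferentiableAt ℝ C z) (v : E × E) :
    pullbackCov (bundleMetric G f) id (fun x => liftVec G x (A x) (C x)) z v = liftVec G z
      (fderiv ℝ A z v + christoffel G z.1 v.1 (A z)
        - ((1 / 2) * G z.1 (vertForm G z v) (C z)) • localGrad G f z.1)
      (fderiv ℝ C z v + christoffel G z.1 v.1 (C z)
        + (1 / (2 * f z.1)) • (fderiv ℝ f z.1 v.1 • C z
          + fderiv ℝ f z.1 (A z) • vertForm G z v)) := by
  have hG := h.metric
  have hB : HasFDerivAt (fun x : E × E => christoffel G x.1)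
      ((fderiv ℝ (christoffel G) z.1).comp (ContinuousLinearMap.fst ℝ E E)) z :=
    (hG.differentiableAt_christoffel hz).hasFDerivAt.comp z (hasFDerivAt_fst (𝕜 := ℝ) (p := z))
  have hL := hA.hasFDerivAt.prodMk (hC.hasFDerivAt.fun_sub
    ((hB.clm_apply hA.hasFDerivAt).clm_apply (hasFDerivAt_snd (𝕜 := ℝ) (p := z))))
  rw [pullbackCov_id, HasFDerivAt.fderiv (f := fun x => liftVec G x (A x) (C x)) hL,
    hG.christoffel_bundleMetric h.flat h.smooth h.pos hz]
  -- In the vertical component, the derivative of the term `Γ(A, y)` inside `liftVec` cancels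
  -- against the derivative of `vertForm` in the Christoffel symbols.
  refine vertForm_ext (z := z) (G := G) ?_ ?_
  · simp only [ContinuousLinearMap.prod_apply, Prod.fst_add, liftVec_fst, vertForm_liftVec]
    abel
  · rw [map_add, vertForm_liftVec, vertForm_liftVec, liftVec_fst, vertForm_liftVec,
      hG.fderiv_vertForm hz, vertForm_apply]
    simp only [liftVec, ContinuousLinearMap.prod_apply, sub_apply, add_apply,
      ContinuousLinearMap.comp_apply, ContinuousLinearMap.flip_apply, ContinuousLinearMap.coe_fst',
      ContinuousLinearMap.coe_snd']
    abel

variable {T : E → E}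

/-- The covariant derivative of the horizontal lift of `T`. -/
theorem IsFlatWeighted.pullbackCov_horizontal (h : IsFlatWeighted G f U) (hz : z.1 ∈ U)
    (hT : DifferentiableAt ℝ T z.1) (v : E × E) :
    pullbackCov (bundleMetric G f) id (fun x => liftVec G x (T x.1) 0) z v = liftVec G z
      (pullbackCov G id T z.1 v.1)
      ((1 / (2 * f z.1) * fderiv ℝ f z.1 (T z.1)) • vertForm G z v) := by
  rw [h.pullbackCov_liftVec hz (A := fun x => T x.1) (C := fun _ => 0)
    (hT.comp z differentiableAt_fst) (differentiableAt_const _), fderiv_comp_fst hT, pullbackCov_id]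
  simp [mul_smul]

/-- The second covariant derivative of a horizontal lift, in horizontal directions. -/
theorem IsFlatWeighted.pullbackCov_pullbackCov_horizontal (h : IsFlatWeighted G f U)
    (hz : z.1 ∈ U) (hT : ContDiffAt ℝ ∞ T z.1) {v w : E × E} (hv : vertForm G z v = 0)
    (hw : vertForm G z w = 0) :
    pullbackCov (bundleMetric G f) id (fun x =>
        pullbackCov (bundleMetric G f) id (fun x => liftVec G x (T x.1) 0) x w) z v =
      liftVec G z (pullbackCov G id (fun y => pullbackCov G id T y w.1) z.1 v.1)
        ((1 / (2 * f z.1) * fderiv ℝ f z.1 (T z.1)) • fderiv ℝ (vertForm G) z v w) := by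
  have hG := h.metric
  have hev : ∀ᶠ x : E × E in 𝓝 z, x.1 ∈ U ∧ DifferentiableAt ℝ T x.1 := by
    refine (continuous_fst.tendsto z).eventually (p := fun y => y ∈ U ∧ DifferentiableAt ℝ T y) ?_
    filter_upwards [hG.isOpen.mem_nhds hz,
      (hT.of_le (m := 1) (by simp)).eventually (by simp)] with y h1 h2
      using ⟨h1, h2.differentiableAt (by simp)⟩
  rw [pullbackCov_id_congr _ (W := fun x => liftVec G x (pullbackCov G id T x.1 w.1)
    ((1 / (2 * f x.1) * fderiv ℝ f x.1 (T x.1)) • vertForm G x w))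
    (hev.mono fun x hx => h.pullbackCov_horizontal hx.1 hx.2 w)]
  have hA : DifferentiableAt ℝ (fun y => pullbackCov G id T y w.1) z.1 :=
    (contDiffAt_pullbackCov_id (hG.contDiffAt_christoffel hz) hT w.1).differentiableAt (by simp)
  have hρ : DifferentiableAt ℝ (fun x : E × E => 1 / (2 * f x.1) * fderiv ℝ f x.1 (T x.1)) z :=
    ((h.contDiffAt_coeff hz hT).differentiableAt (by simp)).comp z differentiableAt_fst
  -- The direction `w` is constant in coordinates, so its vertical component vanishes at `z` but not
  -- nearby, and the derivative of that component survives.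
  have hver := (hG.differentiableAt_vertForm hz).hasFDerivAt.clm_apply (hasFDerivAt_const w z)
  have hC := hρ.hasFDerivAt.fun_smul hver
  rw [h.pullbackCov_liftVec hz (A := fun x => pullbackCov G id T x.1 w.1)
    (C := fun x => (1 / (2 * f x.1) * fderiv ℝ f x.1 (T x.1)) • vertForm G x w)
    (hA.comp z differentiableAt_fst) hC.differentiableAt, fderiv_comp_fst hA, hC.fderiv, hv, hw,
    pullbackCov_id G (fun y => pullbackCov G id T y w.1)]
  simp

/-- The Ricci identity is applied to the horizontal lift of the constant field `e`. The horizontal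
part is the curvature of `G`; the vertical part is a multiple of the antisymmetrized derivative of
`vertForm`, which by flatness vanishes on horizontal vectors. -/
theorem IsFlatWeighted.curvature_horizontal (h : IsFlatWeighted G f U) (hz : z.1 ∈ U) (t e : E) :
    curvature (bundleMetric G f) z (liftVec G z t 0) (liftVec G z e 0) (liftVec G z e 0) = 0 := by
  have hG := h.metric
  have hΓ := (hG.bundleMetric h.smooth h.pos).contDiffAt_christoffel (y := z) hz
  have hV : ContDiffAt ℝ ∞ (fun x : E × E => liftVec G x e 0) z :=
    hG.contDiffAt_liftVec hz contDiffAt_const contDiffAt_const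
  have hr := ricci_identity (hG.contDiffAt_christoffel hz) (contDiffAt_const (c := e)) t e
  rw [h.flat _ hz] at hr
  rw [← ricci_identity hΓ hV,
    h.pullbackCov_pullbackCov_horizontal hz (T := fun _ => e) contDiffAt_const
      (vertForm_liftVec _ _ _) (vertForm_liftVec _ _ _),
    h.pullbackCov_pullbackCov_horizontal hz (T := fun _ => e) contDiffAt_const
      (vertForm_liftVec _ _ _) (vertForm_liftVec _ _ _), liftVec_sub, liftVec_fst, liftVec_fst, hr,
    ← smul_sub, hG.fderiv_vertForm_sub h.flat hz]
  simp [liftVec_zero]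

/-- The Ricci identity is applied to the constant vertical field `(0, b)`, whose covariant
derivatives have both components explicit. -/
theorem IsFlatWeighted.curvature_vertical (h : IsFlatWeighted G f U) (hz : z.1 ∈ U) (t b : E) :
    curvature (bundleMetric G f) z (liftVec G z t 0) (0, b) (0, b) =
      liftVec G z (G z.1 b b • (-(1 / 2 : ℝ) • pullbackCov G id (localGrad G f) z.1 t
        + (1 / (4 * f z.1) * fderiv ℝ f z.1 t) • localGrad G f z.1)) 0 := by
  have hG := h.metric
  have hΓ := (hG.bundleMetric h.smooth h.pos).contDiffAt_christoffel (y := z) hz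
  have hX : ContDiffAt ℝ ∞ (localGrad G f) z.1 := hG.contDiffAt_localGrad hz (h.contDiffAt hz)
  have hXd := (hX.differentiableAt (by simp)).hasFDerivAt
  have hfst := hasFDerivAt_fst (𝕜 := ℝ) (p := z)
  have hV : (fun _ : E × E => ((0 : E), b)) = fun x => liftVec G x 0 b := by
    funext x
    rw [liftVec_zero_left]
  set u := liftVec G z t 0 with hu
  have hcov : ∀ v x, x.1 ∈ U → pullbackCov (bundleMetric G f) id (fun _ => ((0 : E), b)) x v =
      liftVec G x (-((1 / 2 * G x.1 (vertForm G x v) b) • localGrad G f x.1))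
        (christoffel G x.1 v.1 b + (1 / (2 * f x.1) * fderiv ℝ f x.1 v.1) • b) := fun v x hx => by
    rw [hV, h.pullbackCov_liftVec hx (A := fun _ => 0) (C := fun _ => b)
      (differentiableAt_const _) (differentiableAt_const _)]
    simp [mul_smul]
  have hev : ∀ᶠ x : E × E in 𝓝 z, x.1 ∈ U :=
    (hG.isOpen.preimage continuous_fst).mem_nhds hz
  have hGf : HasFDerivAt (fun x : E × E => G x.1)
      ((fderiv ℝ G z.1).comp (ContinuousLinearMap.fst ℝ E E)) z :=
    (hG.differentiableAt hz).hasFDerivAt.comp z hfst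
  have hXf : HasFDerivAt (fun x : E × E => localGrad G f x.1)
      ((fderiv ℝ (localGrad G f) z.1).comp (ContinuousLinearMap.fst ℝ E E)) z :=
    hXd.comp z hfst
  have h1 : pullbackCov (bundleMetric G f) id (fun x =>
      pullbackCov (bundleMetric G f) id (fun _ => ((0 : E), b)) x (0, b)) z u =
      liftVec G z (-((1 / 2 * fderiv ℝ G z.1 t b b) • localGrad G f z.1)
        - (1 / 2 * G z.1 b b) • pullbackCov G id (localGrad G f) z.1 t) 0 := by
    rw [pullbackCov_id_congr _ (W := fun x => liftVec G x
      (-((1 / 2 * G x.1 b b) • localGrad G f x.1)) 0) (hev.mono fun x hx => by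
        simp only [hcov _ x hx, vertForm_zero_left, map_zero, mul_zero, zero_smul, add_zero,
          zero_apply])]
    have hA := ((((hGf.clm_apply (hasFDerivAt_const b z)).clm_apply
      (hasFDerivAt_const b z)).const_mul (1 / 2)).fun_smul hXf).fun_neg
    rw [h.pullbackCov_liftVec hz (C := fun _ => 0) hA.differentiableAt (differentiableAt_const _),
      hA.fderiv, pullbackCov_id]
    congr 1
    · simp [hu]
      module
    · simp [hu]
  -- The vertical component of the constant vector `u` is zero at `z` but changes along the fibre;
  -- this rate enters `h2`.
  have hbu : fderiv ℝ (vertForm G) z (0, b) u = christoffel G z.1 t b := by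
    rw [hG.fderiv_vertForm hz]
    simp [hu]
  have h2 : pullbackCov (bundleMetric G f) id (fun x =>
      pullbackCov (bundleMetric G f) id (fun _ => ((0 : E), b)) x u) z (0, b) =
      liftVec G z (-((1 / 2 * G z.1 (christoffel G z.1 t b) b) • localGrad G f z.1)
        - ((1 / 2) * G z.1 b (christoffel G z.1 t b
            + (1 / (2 * f z.1) * fderiv ℝ f z.1 t) • b)) • localGrad G f z.1) 0 := by
    rw [pullbackCov_id_congr _ (W := fun x => liftVec G x
      (-((1 / 2 * G x.1 (vertForm G x u) b) • localGrad G f x.1))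
      ((fun y => christoffel G y t b + (1 / (2 * f y) * fderiv ℝ f y t) • b) x.1))
      (hev.mono fun x hx => hcov _ x hx)]
    have hA := ((((hGf.clm_apply ((hG.differentiableAt_vertForm hz).hasFDerivAt.clm_apply
      (hasFDerivAt_const u z))).clm_apply
      (hasFDerivAt_const b z)).const_mul (1 / 2)).fun_smul hXf).fun_neg
    have hC : DifferentiableAt ℝ
        (fun y => christoffel G y t b + (1 / (2 * f y) * fderiv ℝ f y t) • b) z.1 :=
      ((((hG.contDiffAt_christoffel hz).clm_apply contDiffAt_const).clm_apply
        contDiffAt_const).add ((h.contDiffAt_coeff hz (T := fun _ => t)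
          contDiffAt_const).smul contDiffAt_const)).differentiableAt (by simp)
    rw [h.pullbackCov_liftVec hz
      (C := fun x => (fun y => christoffel G y t b + (1 / (2 * f y) * fderiv ℝ f y t) • b) x.1)
      hA.differentiableAt (hC.comp z differentiableAt_fst),
      hA.fderiv, fderiv_comp_fst hC]
    congr 1
    · rw [hu] at hbu
      simp [hu, hbu, vertForm_zero_left]
    · simp [hu]
  rw [← ricci_identity hΓ (V := fun _ => ((0 : E), b)) contDiffAt_const, h1, h2, liftVec_sub,
    sub_zero]
  congr 1
  have hs := hG.symm _ hz
  have hne := (h.pos _ hz).ne'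
  -- Compatibility gives `D_t G(b,b) = 2 G(Γ(t,b), b)`, which cancels both Christoffel terms of
  -- `h2`.
  rw [hG.fderiv_apply hz, hs b (christoffel G z.1 t b), map_add, map_smul, smul_eq_mul,
    hs b (christoffel G z.1 t b)]
  match_scalars
  · ring
  · field_simp

end BundleConnection

/-! ### Tension and bitension fields in coordinates -/

section LocalTension

variable {E : Type*} [NormedAddCommGroup E] [NormedSpace ℝ E] [FiniteDimensional ℝ E]
  {G : E → E →L[ℝ] E →L[ℝ] ℝ} {U : Set E} {f : E → ℝ} {z : E × E}

/-- Traces with respect to the Sasaki metric. -/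
theorem IsMetricOn.metricTrace_bundleMetric_one {F : Type*} [NormedAddCommGroup F]
    [NormedSpace ℝ F] (hG : IsMetricOn G U) (hz : z.1 ∈ U) {ι : Type*} [Fintype ι] {e : ι → E}
    (he : ∀ v, ∑ i, G z.1 (e i) v • e i = v) {B : E × E → E × E → F}
    (hB : ∃ B' : E × E →ₗ[ℝ] E × E →ₗ[ℝ] F, ∀ v w, B v w = B' v w) :
    metricTrace (MusSasaki.bundleMetric G (fun _ => 1) z) B =
      ∑ i, B (liftVec G z (e i) 0) (liftVec G z (e i) 0) + ∑ i, B (0, e i) (0, e i) := by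
  obtain ⟨B', hB'⟩ := hB
  obtain rfl : B = fun v w => B' v w := by
    funext v w
    exact hB' v w
  have hM := hG.bundleMetric (f := fun _ => 1) contDiffOn_const (fun _ _ => one_pos)
  rw [metricTrace_eq_sum (hM.isInvertible hz) (hM.symm z hz)
    (e := Sum.elim (fun i => liftVec G z (e i) 0) (fun i => (0, e i)))]
  · simp
  · intro v
    simp only [Fintype.sum_sum_type, Sum.elim_inl, Sum.elim_inr, bundleMetric_apply, liftVec_fst,
      vertForm_liftVec, vertForm_zero_left, map_zero, zero_apply, add_zero, zero_add,
      one_mul]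
    -- The horizontal lifts reproduce the horizontal component and the vertical lifts the vertical
    -- one.
    refine vertForm_ext (z := z) (G := G) ?_ ?_
    · rw [Prod.fst_add, Prod.fst_sum, Prod.fst_sum]
      simp [he]
    · simp [vertForm_zero_left, he]

/-- For the identity, `∇dφ` is the difference of the two connections. -/
theorem localTension_id (GM GN : E → E →L[ℝ] E →L[ℝ] ℝ) (y : E) :
    localTension GM GN id y =
      metricTrace (GM y) (fun v w => (christoffel GN y - christoffel GM y) v w) := by
  have : secondFundForm GM GN id y = fun v w => (christoffel GN y - christoffel GM y) v w := by
    funext v w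
    simp [secondFundForm, pullbackCov_id]
  rw [localTension, this]

theorem localBitension_id (GM GN : E → E →L[ℝ] E →L[ℝ] ℝ) (y : E) :
    localBitension GM GN id y =
      - metricTrace (GM y) (curvature GN y (localTension GM GN id y))
        - traceSecondCov GM GN id (localTension GM GN id) y := by
  simp [localBitension]

/-- The parts of the connections independent of the weight cancel. On a horizontal unit vector
nothing is left; on each vertical one, `-½ grad f` is. -/
theorem IsFlatWeighted.localTension_eq (h : IsFlatWeighted G f U) (hz : z.1 ∈ U) :
    localTension (bundleMetric G fun _ => 1) (bundleMetric G f) id z =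
      liftVec G z (-((Module.finrank ℝ E : ℝ) / 2) • localGrad G f z.1) 0 := by
  have hG := h.metric
  obtain ⟨e, he1, he⟩ := exists_orthonormal_frame (hG.symm _ hz) (hG.pos _ hz)
  have h1 := h.one
  rw [localTension_id, hG.metricTrace_bundleMetric_one hz he
    (B := fun v w =>
      (christoffel (bundleMetric G f) z - christoffel (bundleMetric G fun _ => 1) z) v w)
    ⟨LinearMap.mk₂ ℝ (fun v w =>
      (christoffel (bundleMetric G f) z - christoffel (bundleMetric G fun _ => 1) z) v w)
      (by intros; rw [map_add, add_apply]) (by intros; rw [map_smul, smul_apply])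
      (by intros; rw [map_add]) (by intros; rw [map_smul]), fun _ _ => rfl⟩]
  simp only [sub_apply, hG.christoffel_bundleMetric h.flat h.smooth h.pos hz,
    hG.christoffel_bundleMetric h1.flat h1.smooth h1.pos hz, liftVec_sub, vertForm_liftVec,
    vertForm_zero_left, localGrad_const, he1]
  simp [liftVec_zero, liftVec_smul, ← Nat.cast_smul_eq_nsmul ℝ,
    smul_smul, div_eq_mul_inv]

theorem IsFlatWeighted.trace_curvature (h : IsFlatWeighted G f U) (hz : z.1 ∈ U) (t : E) :
    metricTrace (bundleMetric G (fun _ => 1) z) (curvature (bundleMetric G f) z (liftVec G z t 0)) =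
      liftVec G z ((Module.finrank ℝ E : ℝ) •
        (-(1 / 2 : ℝ) • pullbackCov G id (localGrad G f) z.1 t
        + (1 / (4 * f z.1) * fderiv ℝ f z.1 t) • localGrad G f z.1)) 0 := by
  have hG := h.metric
  obtain ⟨e, he1, he⟩ := exists_orthonormal_frame (hG.symm _ hz) (hG.pos _ hz)
  rw [hG.metricTrace_bundleMetric_one hz he (exists_curvature_bilin
    ((hG.bundleMetric h.smooth h.pos).differentiableAt_christoffel hz) _)]
  simp only [h.curvature_horizontal hz, h.curvature_vertical hz, he1, one_smul, liftVec_sum]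
  rw [Finset.sum_const_zero, zero_add, Finset.sum_const, Finset.card_univ, Fintype.card_fin,
    Nat.cast_smul_eq_nsmul]

variable {T : E → E}

/-- Horizontal directions reproduce `Tr ∇²T`. Along a vertical `b`, the first derivative of `T^H` is
`ρ b^V` with `ρ = df(T)/(2f)`, and the second is `-½ ρ ‖b‖² grad f`, horizontal. -/
theorem IsFlatWeighted.traceSecondCov_horizontal (h : IsFlatWeighted G f U) (hz : z.1 ∈ U)
    (hT : ContDiffAt ℝ ∞ T z.1) :
    traceSecondCov (bundleMetric G fun _ => 1) (bundleMetric G f) id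
        (fun x => liftVec G x (T x.1) 0) z =
      liftVec G z (traceSecondCov G G id T z.1
        - ((Module.finrank ℝ E : ℝ) / (4 * f z.1) * fderiv ℝ f z.1 (T z.1))
          • localGrad G f z.1) 0 := by
  have hG := h.metric
  have h1 := h.one
  obtain ⟨e, he1, he⟩ := exists_orthonormal_frame (hG.symm _ hz) (hG.pos _ hz)
  have hΓ := (hG.bundleMetric h.smooth h.pos).contDiffAt_christoffel (y := z) hz
  have hV : ContDiffAt ℝ ∞ (fun x : E × E => liftVec G x (T x.1) 0) z :=
    hG.contDiffAt_liftVec hz (hT.comp z contDiffAt_fst) contDiffAt_const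
  have hev : ∀ᶠ x : E × E in 𝓝 z, x.1 ∈ U ∧ DifferentiableAt ℝ T x.1 := by
    refine (continuous_fst.tendsto z).eventually (p := fun y => y ∈ U ∧ DifferentiableAt ℝ T y) ?_
    filter_upwards [hG.isOpen.mem_nhds hz,
      (hT.of_le (m := 1) (by simp)).eventually (by simp)] with y h1 h2
      using ⟨h1, h2.differentiableAt (by simp)⟩
  -- The vertical parts cancel: both the second derivative and the correction by the Sasaki
  -- connection contain the same derivative of `vertForm`.
  have hhor : ∀ a, secondCov (bundleMetric G fun _ => 1) (bundleMetric G f) id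
      (fun x => liftVec G x (T x.1) 0) z (liftVec G z a 0) (liftVec G z a 0) =
      liftVec G z (secondCov G G id T z.1 a a) 0 := fun a => by
    rw [secondCov, h.pullbackCov_pullbackCov_horizontal hz hT (vertForm_liftVec _ _ _)
      (vertForm_liftVec _ _ _), h.pullbackCov_horizontal hz (hT.differentiableAt (by simp)),
      liftVec_sub, hG.christoffel_bundleMetric h1.flat h1.smooth h1.pos hz, secondCov]
    simp [localGrad_const]
  have hver : ∀ b, secondCov (bundleMetric G fun _ => 1) (bundleMetric G f) id
      (fun x => liftVec G x (T x.1) 0) z (0, b) (0, b) =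
      liftVec G z (-(G z.1 b b • (1 / (4 * f z.1) * fderiv ℝ f z.1 (T z.1))
          • localGrad G f z.1)) 0 := fun b => by
    have hX : christoffel (bundleMetric G fun _ => 1) z (0, b) (0, b) = 0 := by
      rw [hG.christoffel_bundleMetric h1.flat h1.smooth h1.pos hz, hG.fderiv_vertForm hz]
      simp [localGrad_const, liftVec_zero]
    have hρ := (h.contDiffAt_coeff hz hT).differentiableAt (by simp)
    have hC : DifferentiableAt ℝ
        (fun y => (1 / (2 * f y) * fderiv ℝ f y (T y)) • b) z.1 := hρ.smul_const b
    rw [secondCov, hX, pullbackCov_id_congr _ (W := fun x => liftVec G x 0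
      ((fun y => (1 / (2 * f y) * fderiv ℝ f y (T y)) • b) x.1))
      (hev.mono fun x hx => by
        simp only [h.pullbackCov_horizontal hx.1 hx.2, vertForm_zero_left, pullbackCov_id]
        simp)]
    rw [h.pullbackCov_liftVec hz (A := fun _ => 0)
      (C := fun x => (fun y => (1 / (2 * f y) * fderiv ℝ f y (T y)) • b) x.1)
      (differentiableAt_const _) (hC.comp z differentiableAt_fst), fderiv_comp_fst hC,
      pullbackCov_id]
    simp only [map_zero, zero_apply, add_zero, fderiv_fun_const, Pi.zero_apply, zero_smul,
      smul_zero, zero_sub, vertForm_zero_left, map_smul, smul_eq_mul, sub_zero]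
    congr 1
    have hne := (h.pos _ hz).ne'
    match_scalars
    field_simp
    ring
  rw [traceSecondCov, hG.metricTrace_bundleMetric_one hz he (exists_secondCov_bilin hΓ hV)]
  simp only [hhor, hver, he1, one_smul, liftVec_sum, liftVec_add, add_zero]
  obtain ⟨B, hB⟩ := exists_secondCov_bilin (GM := G) (hG.contDiffAt_christoffel hz) hT
  have htr : traceSecondCov G G id T z.1 = ∑ i, secondCov G G id T z.1 (e i) (e i) := by
    have := metricTrace_eq_sum (hG.isInvertible hz) (hG.symm _ hz) he B
    simp only [← hB] at this
    exact this
  rw [htr, Finset.sum_const, Finset.card_univ, Fintype.card_fin, ← Nat.cast_smul_eq_nsmul ℝ]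
  congr 1
  match_scalars <;> ring

/-- The `1/f` terms of `trace_curvature` and `traceSecondCov_horizontal` are opposite, so no `f`
remains outside its gradient. -/
theorem IsFlatWeighted.localBitension_eq (h : IsFlatWeighted G f U) (hz : z.1 ∈ U) :
    localBitension (bundleMetric G fun _ => 1) (bundleMetric G f) id z =
      liftVec G z (((Module.finrank ℝ E : ℝ) / 2) • (traceSecondCov G G id (localGrad G f) z.1
        - ((Module.finrank ℝ E : ℝ) / 2) •
          pullbackCov G id (localGrad G f) z.1 (localGrad G f z.1))) 0 := by
  have hG := h.metric
  have hX : ContDiffAt ℝ ∞ (localGrad G f) z.1 := hG.contDiffAt_localGrad hz (h.contDiffAt hz)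
  have hτ : localTension (bundleMetric G fun _ => 1) (bundleMetric G f) id =ᶠ[𝓝 z]
      fun x => liftVec G x (-((Module.finrank ℝ E : ℝ) / 2) • localGrad G f x.1) 0 := by
    filter_upwards [(hG.isOpen.preimage continuous_fst).mem_nhds hz] with x hx
      using h.localTension_eq hx
  have hid : ContinuousAt (id : E × E → E × E) z := continuousAt_id
  rw [localBitension_id, h.localTension_eq hz, h.trace_curvature hz,
    traceSecondCov_congr .rfl .rfl .rfl hid hτ,
    h.traceSecondCov_horizontal hz
      (T := fun y => -((Module.finrank ℝ E : ℝ) / 2) • localGrad G f y) (hX.const_smul _),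
    traceSecondCov_const_smul ((((hX.of_le (m := 1) (by simp)).eventually (by simp)).mono
      fun y hy => hy.differentiableAt (by simp)))
      fun v => (contDiffAt_pullbackCov_id (hG.contDiffAt_christoffel hz) hX v).differentiableAt
        (by simp)]
  rw [← neg_one_smul ℝ (liftVec G z _ 0), liftVec_smul, liftVec_sub]
  simp only [pullbackCov_id, map_smul, smul_apply, smul_eq_mul, smul_zero, sub_zero]
  congr 1
  match_scalars <;> ring

/-- The gradient of `‖grad f‖²` is `2 ∇_{grad f} grad f`. -/
theorem IsMetricOn.localGrad_normSq (hG : IsMetricOn G U) {y : E} (hy : y ∈ U)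
    (hf : ContDiffAt ℝ ∞ f y) :
    localGrad G (fun x => G x (localGrad G f x) (localGrad G f x)) y =
      (2 : ℝ) • pullbackCov G id (localGrad G f) y (localGrad G f y) := by
  set X := localGrad G f
  have hX := ((hG.contDiffAt_localGrad hy hf).differentiableAt (by simp)).hasFDerivAt
  have hGd := (hG.differentiableAt hy).hasFDerivAt
  -- The left side is the Hessian of `f`; the right side makes its symmetry visible.
  have hess : ∀ v w, G y (pullbackCov G id X y v) w =
      fderiv ℝ (fderiv ℝ f) y v w - fderiv ℝ f y (christoffel G y v w) := fun v w => by
    have h1 : (fun x => G x (X x) w) =ᶠ[𝓝 y] fun x => fderiv ℝ f x w := by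
      filter_upwards [hG.isOpen.mem_nhds hy] with x hx using hG.apply_localGrad hx w
    have h2 := ((hGd.clm_apply hX).clm_apply (hasFDerivAt_const w y)).fderiv
    have hD : DifferentiableAt ℝ (fderiv ℝ f) y :=
      (hf.fderiv_right (m := ∞) (by simp)).differentiableAt (by simp)
    have h3 := (hD.hasFDerivAt.clm_apply (hasFDerivAt_const w y)).fderiv
    rw [h1.fderiv_eq, h3] at h2
    have h4 := DFunLike.congr_fun h2 v
    simp only [add_apply, ContinuousLinearMap.comp_apply, ContinuousLinearMap.flip_apply,
      zero_apply, map_zero, zero_add, hG.fderiv_apply hy] at h4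
    rw [h4, pullbackCov_id, map_add, add_apply, hG.apply_localGrad hy]
    ring
  have hsymm : ∀ v w, G y (pullbackCov G id X y v) w = G y (pullbackCov G id X y w) v := by
    intro v w
    rw [hess, hess, hG.christoffel_symm hy v w, (hf.isSymmSndFDerivAt (by
      simp only [minSmoothness_of_isRCLikeNormedField]
      exact WithTop.coe_le_coe.2 le_top)).eq v w]
  refine hG.eq_of_forall hy fun w => ?_
  rw [hG.apply_localGrad hy, ((hGd.clm_apply hX).clm_apply hX).fderiv, map_smul, smul_apply, hsymm,
    pullbackCov_id]
  simp only [add_apply, ContinuousLinearMap.comp_apply, ContinuousLinearMap.flip_apply, map_add,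
    hG.fderiv_apply hy, smul_eq_mul]
  rw [hG.symm y hy (X y) (fderiv ℝ X y w), hG.symm y hy (X y) (christoffel G y w (X y))]
  ring

end LocalTension

/-! ### Christoffel symbols under a change of coordinates -/

section Transition

variable {E : Type*} [NormedAddCommGroup E] [NormedSpace ℝ E] [FiniteDimensional ℝ E]
  {G G' : E → E →L[ℝ] E →L[ℝ] ℝ} {U U' : Set E} {y : E} {θ : E → E}

/-- The transformation law of the Christoffel symbols under an isometry `θ`. -/
theorem IsMetricOn.fderiv_christoffel (hG : IsMetricOn G U) (hG' : IsMetricOn G' U') (hy : y ∈ U)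
    (hy' : θ y ∈ U') (hθ : ContDiffAt ℝ ∞ θ y)
    (hiso : ∀ᶠ x in 𝓝 y, ∀ a b, G x a b = G' (θ x) (fderiv ℝ θ x a) (fderiv ℝ θ x b)) (a b : E) :
    fderiv ℝ θ y (christoffel G y a b) =
      fderiv ℝ (fderiv ℝ θ) y a b + christoffel G' (θ y) (fderiv ℝ θ y a) (fderiv ℝ θ y b) := by
  have hiso' := hiso.self_of_nhds
  have hinj : Function.Injective (fderiv ℝ θ y : E →ₗ[ℝ] E) := by
    rw [injective_iff_map_eq_zero]
    intro v hv
    by_contra h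
    have h1 := hG.pos y hy v h
    rw [hiso', show fderiv ℝ θ y v = 0 from hv, map_zero] at h1
    exact lt_irrefl _ h1
  have hsurj := LinearMap.injective_iff_surjective.1 hinj
  -- `C` is the connection of `G'` pulled back by `θ`; it exists because an isometry has injective,
  -- hence surjective, differential. It is symmetric and compatible with `G`, so it is the
  -- Levi-Civita connection of `G`.
  choose C hC using fun v w => hsurj (fderiv ℝ (fderiv ℝ θ) y v w +
    christoffel G' (θ y) (fderiv ℝ θ y v) (fderiv ℝ θ y w))
  simp only [ContinuousLinearMap.coe_coe] at hC
  have hsymm : ∀ v w, fderiv ℝ (fderiv ℝ θ) y v w = fderiv ℝ (fderiv ℝ θ) y w v :=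
    fun v w => (hθ.isSymmSndFDerivAt (by
      simp only [minSmoothness_of_isRCLikeNormedField]
      exact WithTop.coe_le_coe.2 le_top)).eq v w
  have hD : HasFDerivAt (fderiv ℝ θ) (fderiv ℝ (fderiv ℝ θ) y) y :=
    ((hθ.fderiv_right (m := ∞) (by simp)).differentiableAt (by simp)).hasFDerivAt
  rw [hG.christoffel_eq hy (C := C), hC]
  · intro v w
    refine hinj ?_
    simp only [ContinuousLinearMap.coe_coe]
    rw [hC, hC, hsymm, hG'.christoffel_symm hy']
  · intro v w z
    have h1 : (fun x => G x w z) =ᶠ[𝓝 y] fun x => G' (θ x) (fderiv ℝ θ x w) (fderiv ℝ θ x z) :=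
      hiso.mono fun x hx => hx w z
    have h2 : HasFDerivAt (fun x => G' (θ x)) ((fderiv ℝ G' (θ y)).comp (fderiv ℝ θ y)) y :=
      (hG'.differentiableAt hy').hasFDerivAt.comp y (hθ.differentiableAt (by simp)).hasFDerivAt
    have h3 := (h2.clm_apply (hD.clm_apply (hasFDerivAt_const w y))).clm_apply
      (hD.clm_apply (hasFDerivAt_const z y))
    rw [← fderiv_apply₂ (hG.differentiableAt hy), h1.fderiv_eq, h3.fderiv, hiso', hiso', hC, hC]
    simp only [add_apply, ContinuousLinearMap.comp_apply, ContinuousLinearMap.flip_apply,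
      zero_apply, map_zero, zero_add, hG'.fderiv_apply hy', map_add]
    ring

end Transition

/-! ### Preferred charts and their transition maps -/

section Charts

variable {E : Type*} [NormedAddCommGroup E] [NormedSpace ℝ E]
  {H : Type*} [TopologicalSpace H] {I : ModelWithCorners ℝ E H}
  {M : Type*} [TopologicalSpace M] [ChartedSpace H M]

variable (I) in
/-- The change of coordinates from the preferred chart at `p` to the one at `q`. -/
def chartTransition (p q : M) : E → E := extChartAt I q ∘ (extChartAt I p).symm

theorem mem_chartAt_source {p : M} {y : E} (hy : y ∈ (extChartAt I p).target) :
    (extChartAt I p).symm y ∈ (chartAt H p).source := by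
  rw [← extChartAt_source I]
  exact (extChartAt I p).map_target hy

section

variable [I.Boundaryless] [IsManifold I ∞ M]

theorem chartTransition_contDiffAt {p q : M} {y : E} (hy : y ∈ (extChartAt I p).target)
    (hq : (extChartAt I p).symm y ∈ (extChartAt I q).source) :
    ContDiffAt ℝ ∞ (chartTransition I p q) y := by
  have := contDiffWithinAt_ext_coord_change (I := I) (n := ∞) q p (y := y) (by
    rw [PartialEquiv.trans_source]
    exact ⟨hy, hq⟩)
  rwa [I.range_eq_univ, contDiffWithinAt_univ] at this

end

variable [IsManifold I 1 M]

theorem tangentCoordChange_injective {p : M} {y : E} (hy : y ∈ (extChartAt I p).target) :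
    Function.Injective (tangentCoordChange I p ((extChartAt I p).symm y)
      ((extChartAt I p).symm y)) := by
  have hp := (extChartAt I p).map_target hy
  refine Function.LeftInverse.injective (g := tangentCoordChange I ((extChartAt I p).symm y) p
    ((extChartAt I p).symm y)) fun v => ?_
  rw [tangentCoordChange_comp ⟨⟨hp, mem_extChartAt_source _⟩, hp⟩, tangentCoordChange_self hp]

theorem metricInChart_apply (g : ∀ x : M, TangentSpace I x →L[ℝ] TangentSpace I x →L[ℝ] ℝ)
    {p : M} {y : E} (hy : y ∈ (extChartAt I p).target) (a b : E) :
    metricInChart I g p y a b = g ((extChartAt I p).symm y)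
      (tangentCoordChange I p ((extChartAt I p).symm y) ((extChartAt I p).symm y) a)
      (tangentCoordChange I p ((extChartAt I p).symm y) ((extChartAt I p).symm y) b) := by
  rw [metricInChart, pullForm_apply,
    TangentBundle.symmL_trivializationAt_eq_core (mem_chartAt_source hy)]
  rfl

theorem symmL_fieldInChart (X : ∀ x : M, TangentSpace I x) {p : M} {y : E}
    (hy : y ∈ (extChartAt I p).target) :
    (trivializationAt E (TangentSpace I : M → Type _) p).symmL ℝ ((extChartAt I p).symm y)
      (fieldInChart I X p y) = X ((extChartAt I p).symm y) :=
  Bundle.Trivialization.symmL_continuousLinearMapAt _ (mem_chartAt_source hy) _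

theorem normSq_symm (g : ∀ x : M, TangentSpace I x →L[ℝ] TangentSpace I x →L[ℝ] ℝ)
    (X : ∀ x : M, TangentSpace I x) {p : M} {y : E} (hy : y ∈ (extChartAt I p).target) :
    normSq I g X ((extChartAt I p).symm y) =
      metricInChart I g p y (fieldInChart I X p y) (fieldInChart I X p y) := by
  rw [metricInChart, pullForm_apply, symmL_fieldInChart X hy, normSq]

variable [I.Boundaryless]

theorem tangentCoordChange_eq_fderiv {p q : M} {y : E} (hy : y ∈ (extChartAt I p).target) :
    tangentCoordChange I p q ((extChartAt I p).symm y) = fderiv ℝ (chartTransition I p q) y := by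
  rw [tangentCoordChange_def, I.range_eq_univ, fderivWithin_univ, (extChartAt I p).right_inv hy]
  rfl

/-- Both sides are `g` at the same point of `M`, and the cocycle identity of `tangentCoordChange`
matches the arguments. Chart transitions are thus isometries, as the Christoffel transformation law
requires. -/
theorem metricInChart_transition
    (g : ∀ x : M, TangentSpace I x →L[ℝ] TangentSpace I x →L[ℝ] ℝ) {p q : M} {y : E}
    (hy : y ∈ (extChartAt I p).target)
    (hq : (extChartAt I p).symm y ∈ (extChartAt I q).source) (a b : E) :
    metricInChart I g p y a b = metricInChart I g q (chartTransition I p q y)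
      (fderiv ℝ (chartTransition I p q) y a) (fderiv ℝ (chartTransition I p q) y b) := by
  have hs : (extChartAt I q).symm (chartTransition I p q y) = (extChartAt I p).symm y :=
    (extChartAt I q).left_inv hq
  have ht : chartTransition I p q y ∈ (extChartAt I q).target := (extChartAt I q).map_source hq
  have hp := (extChartAt I p).map_target hy
  have hc : ∀ v, tangentCoordChange I q ((extChartAt I p).symm y) ((extChartAt I p).symm y)
      (fderiv ℝ (chartTransition I p q) y v) =
      tangentCoordChange I p ((extChartAt I p).symm y) ((extChartAt I p).symm y) v := fun v => by
    rw [← tangentCoordChange_eq_fderiv hy]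
    exact tangentCoordChange_comp ⟨⟨hp, hq⟩, mem_extChartAt_source _⟩
  rw [metricInChart_apply g hy, metricInChart_apply g ht, hs, hc, hc]

end Charts

/-! ### Metric and gradient in charts -/

section RiemannianManifold

variable {E : Type*} [NormedAddCommGroup E] [NormedSpace ℝ E] [FiniteDimensional ℝ E]
  {H : Type*} [TopologicalSpace H] {I : ModelWithCorners ℝ E H}
  {M : Type*} [TopologicalSpace M] [ChartedSpace H M] [IsManifold I ∞ M]

theorem apply_grad (g : Bundle.ContMDiffRiemannianMetric I ∞ E (TangentSpace I : M → Type _))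
    (f : M → ℝ) (x : M) (v : TangentSpace I x) :
    g.inner x (grad I g.inner f x) v = mvfderiv I f x v := by
  have h := isInvertible_of_pos (E := E) (B := g.inner x) (g.pos x)
  exact DFunLike.congr_fun (apply_inverse_apply (E := E) h (mvfderiv I f x)) v

variable [I.Boundaryless]

theorem isMetricOn_metricInChart (g : Bundle.ContMDiffRiemannianMetric I ∞ E
    (TangentSpace I : M → Type _)) (p : M) :
    IsMetricOn (metricInChart I g.inner p) (extChartAt I p).target where
  isOpen := isOpen_extChartAt_target p
  smooth := by
    refine contDiffOn_clm_apply.2 fun v => contDiffOn_clm_apply.2 fun w y hy => ?_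
    refine ContDiffAt.contDiffWithinAt ?_
    set e := trivializationAt E (TangentSpace I : M → Type _) p
    set q := (extChartAt I p).symm y
    have hq : q ∈ e.baseSet := mem_chartAt_source hy
    -- Constant vectors of the trivialization are smooth local sections, so the metric components
    -- are values of `g` on smooth sections.
    have hsec : ∀ v : E, ContMDiffAt I (I.prod 𝓘(ℝ, E)) ∞
        (fun x => Bundle.TotalSpace.mk' E x (e.symmL ℝ x v)) q := fun v => by
      rw [e.contMDiffAt_section_iff hq]
      refine (contMDiffAt_const (c := v)).congr_of_eventuallyEq ?_
      filter_upwards [e.open_baseSet.mem_nhds hq] with x hx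
      rw [e.symmL_apply hx, e.apply_mk_symm hx]
    have h : ContMDiffAt I (I.prod 𝓘(ℝ)) ∞ (fun x => Bundle.TotalSpace.mk' ℝ
        (E := Bundle.Trivial M ℝ) x (g.inner x (e.symmL ℝ x v) (e.symmL ℝ x w))) q :=
      ContMDiffAt.clm_bundle_apply₂ (F₁ := E) (F₂ := E) g.contMDiff.contMDiffAt (hsec v) (hsec w)
    simp only [Bundle.contMDiffAt_totalSpace] at h
    exact (h.2.comp y ((contMDiffOn_extChartAt_symm (I := I) (n := ∞) p).contMDiffAt
      ((isOpen_extChartAt_target p).mem_nhds hy))).contDiffAt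
  symm := fun y hy v w => g.symm _ _ _
  pos := by
    intro y hy v hv
    rw [metricInChart_apply _ hy]
    exact g.pos _ _ fun h => hv (tangentCoordChange_injective hy (h.trans (map_zero _).symm))

/-- Paired with any vector under the metric, both sides give `df` of that vector, by the chain rule.
-/
theorem fieldInChart_grad (g : Bundle.ContMDiffRiemannianMetric I ∞ E
    (TangentSpace I : M → Type _)) {f : M → ℝ} {p : M} {y : E}
    (hy : y ∈ (extChartAt I p).target) (hf : MDifferentiableAt I 𝓘(ℝ) f ((extChartAt I p).symm y)) :
    fieldInChart I (grad I g.inner f) p y =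
      localGrad (metricInChart I g.inner p) (f ∘ (extChartAt I p).symm) y := by
  have hG := isMetricOn_metricInChart g p
  refine hG.eq_of_forall hy fun v => ?_
  have hs : MDifferentiableWithinAt 𝓘(ℝ, E) I (extChartAt I p).symm (range I) y :=
    mdifferentiableWithinAt_extChartAt_symm hy
  rw [hG.apply_localGrad hy, metricInChart, pullForm_apply, symmL_fieldInChart _ hy, apply_grad,
    TangentBundle.symmL_trivializationAt (mem_chartAt_source hy), (extChartAt I p).right_inv hy]
  rw [I.range_eq_univ, mdifferentiableWithinAt_univ] at hs
  rw [I.range_eq_univ, mfderivWithin_univ, ← mfderiv_eq_fderiv, mfderiv_comp y hf hs]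
  rfl

end RiemannianManifold

/-! ### Charts of the tangent bundle -/

section TangentCharts

variable {E : Type*} [NormedAddCommGroup E] [NormedSpace ℝ E]
  {H : Type*} [TopologicalSpace H] {I : ModelWithCorners ℝ E H}
  {M : Type*} [TopologicalSpace M] [ChartedSpace H M] [IsManifold I 1 M]

theorem extChartAt_tangent_target (P : TangentBundle I M) :
    (extChartAt I.tangent P).target = (extChartAt I P.1).target ×ˢ univ := by
  rw [FiberBundle.extChartAt_target]
  congr 1
  exact inter_eq_left.2 fun y hy => mem_chartAt_source hy

theorem musSasaki_one (g : ∀ x : M, TangentSpace I x →L[ℝ] TangentSpace I x →L[ℝ] ℝ) :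
    musSasaki I g (fun _ => 1) = sasaki I g := by
  funext P
  rw [musSasaki, sasaki, one_smul]

/-- Over its own base point the preferred trivialization is the identity, so a tangent vector
vanishes exactly when its coordinates do. -/
theorem symmL_self_eq_zero_iff {p : M} {v : E} :
    (trivializationAt E (TangentSpace I : M → Type _) p).symmL ℝ p v = 0 ↔ v = 0 := by
  have h : (trivializationAt E (TangentSpace I : M → Type _) p).symmL ℝ p v = v := by
    rw [TangentBundle.symmL_trivializationAt_eq_core (mem_chart_source H p)]
    exact tangentCoordChange_self (E := E) (v := v) (mem_extChartAt_source p)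
  rw [h]
  rfl

theorem symmL_fieldInChart_self (X : ∀ x : M, TangentSpace I x) (p : M) :
    (trivializationAt E (TangentSpace I : M → Type _) p).symmL ℝ p
      (fieldInChart I X p (extChartAt I p p)) = X p := by
  have h := symmL_fieldInChart X (mem_extChartAt_target (I := I) p)
  rwa [extChartAt_to_inv] at h

variable [I.Boundaryless]

theorem writtenInExtChartAt_id_eventuallyEq (P : TangentBundle I M)
    {z : E × E} (hz : z.1 ∈ (extChartAt I P.1).target) :
    writtenInExtChartAt I.tangent I.tangent P (id : TangentBundle I M → TangentBundle I M) =ᶠ[𝓝 z]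
      id := by
  filter_upwards [((isOpen_extChartAt_target (I := I) P.1).preimage continuous_fst).mem_nhds hz]
    with x hx
  refine (extChartAt I.tangent P).right_inv ?_
  rw [extChartAt_tangent_target]
  exact ⟨hx, mem_univ _⟩

/-- The charts of the tangent bundle change by the differential of the change of charts. -/
theorem chartTransition_tangent {P Q : TangentBundle I M} {z : E × E}
    (hz : z.1 ∈ (extChartAt I P.1).target)
    (hQ : (extChartAt I P.1).symm z.1 ∈ (extChartAt I Q.1).source) :
    chartTransition I.tangent P Q z =
      (chartTransition I P.1 Q.1 z.1, fderiv ℝ (chartTransition I P.1 Q.1) z.1 z.2) := by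
  refine Prod.ext rfl ?_
  rw [← tangentCoordChange_eq_fderiv hz]
  exact tangentCoordChange_comp
    ⟨⟨(extChartAt I P.1).map_target hz, mem_extChartAt_source _⟩, hQ⟩

end TangentCharts

/-! ### The Mus-Sasaki metric and the field equations in charts -/

section MusSasakiChart

variable {E : Type*} [NormedAddCommGroup E] [NormedSpace ℝ E] [FiniteDimensional ℝ E]
  {H : Type*} [TopologicalSpace H] {I : ModelWithCorners ℝ E H} [I.Boundaryless]
  {M : Type*} [TopologicalSpace M] [ChartedSpace H M] [IsManifold I ∞ M]

/-- At each point `Q`, `musSasaki` uses the Christoffel symbols of the chart at the base point of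
`Q`, whereas `bundleMetric` uses those of the single chart at `P`. The second derivative of `θ` in
the change of charts of `TM` is the inhomogeneous term of the transformation law, so `verPart`
corresponds to `vertForm`. -/
theorem metricInChart_musSasaki (g : Bundle.ContMDiffRiemannianMetric I ∞ E
    (TangentSpace I : M → Type _)) (f : M → ℝ) (P : TangentBundle I M) {z : E × E}
    (hz : z.1 ∈ (extChartAt I P.1).target) :
    metricInChart I.tangent (musSasaki I g.inner f) P z =
      bundleMetric (metricInChart I g.inner P.1) (f ∘ (extChartAt I P.1).symm) z := by
  set q := (extChartAt I P.1).symm z.1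
  set Q : TangentBundle I M := (extChartAt I.tangent P).symm z
  have hz' : z ∈ (extChartAt I.tangent P).target := by
    rw [extChartAt_tangent_target]
    exact ⟨hz, mem_univ _⟩
  set θ := chartTransition I P.1 q
  have hsrc : q ∈ (extChartAt I q).source := mem_extChartAt_source q
  have hθ : ContDiffAt ℝ ∞ θ z.1 := chartTransition_contDiffAt hz hsrc
  have hG := isMetricOn_metricInChart g P.1
  have hG' := isMetricOn_metricInChart g q
  have hopen := isOpen_extChartAt_target (I := I) P.1
  have hev : ∀ᶠ y in 𝓝 z.1, y ∈ (extChartAt I P.1).target ∧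
      (extChartAt I P.1).symm y ∈ (extChartAt I q).source := by
    filter_upwards [hopen.mem_nhds hz, ((continuousOn_extChartAt_symm P.1).continuousAt
      (hopen.mem_nhds hz)).eventually ((isOpen_extChartAt_source (I := I) q).mem_nhds hsrc)]
      with y h1 h2 using ⟨h1, h2⟩
  have hiso : ∀ᶠ x in 𝓝 z.1, ∀ a b, metricInChart I g.inner P.1 x a b =
      metricInChart I g.inner q (θ x) (fderiv ℝ θ x a) (fderiv ℝ θ x b) :=
    hev.mono fun x hx => metricInChart_transition g.inner hx.1 hx.2
  have htr := hG.fderiv_christoffel hG' hz (mem_extChartAt_target q) hθ hiso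
  have hfd : ∀ v : E × E, fderiv ℝ (chartTransition I.tangent P Q) z v = (fderiv ℝ θ z.1 v.1,
      fderiv ℝ (fderiv ℝ θ) z.1 v.1 z.2 + fderiv ℝ θ z.1 v.2) := fun v => by
    have h1 : chartTransition I.tangent P Q =ᶠ[𝓝 z] fun x => (θ x.1, fderiv ℝ θ x.1 x.2) :=
      (continuous_fst.continuousAt.eventually hev).mono fun x hx =>
        chartTransition_tangent hx.1 hx.2
    have hD : HasFDerivAt (fderiv ℝ θ) (fderiv ℝ (fderiv ℝ θ) z.1) z.1 :=
      ((hθ.fderiv_right (m := ∞) (by simp)).differentiableAt (by simp)).hasFDerivAt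
    have hfst := hasFDerivAt_fst (𝕜 := ℝ) (p := z)
    have h2 : HasFDerivAt (fun x : E × E => fderiv ℝ θ x.1)
      ((fderiv ℝ (fderiv ℝ θ) z.1).comp (ContinuousLinearMap.fst ℝ E E)) z := hD.comp z hfst
    have h3 : HasFDerivAt (fun x : E × E => θ x.1)
      ((fderiv ℝ θ z.1).comp (ContinuousLinearMap.fst ℝ E E)) z :=
      (hθ.differentiableAt (by simp)).hasFDerivAt.comp z hfst
    rw [h1.fderiv_eq, (h3.prodMk (h2.clm_apply (hasFDerivAt_snd (𝕜 := ℝ) (p := z)))).fderiv]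
    simp [add_comm]
  have hmain : ∀ v w : E × E, metricInChart I.tangent (musSasaki I g.inner f) P z v w =
      musSasaki I g.inner f Q (fderiv ℝ (chartTransition I.tangent P Q) z v)
        (fderiv ℝ (chartTransition I.tangent P Q) z w) := fun v w => by
    rw [metricInChart_apply _ hz', ← tangentCoordChange_eq_fderiv hz']
  have hbase : ∀ a b : E, g.inner q (fderiv ℝ θ z.1 a) (fderiv ℝ θ z.1 b) =
      metricInChart I g.inner P.1 z.1 a b := fun a b => by
    rw [metricInChart_apply _ hz, tangentCoordChange_eq_fderiv hz]
  have hver : ∀ v : E × E, verPart I g.inner Q (fderiv ℝ (chartTransition I.tangent P Q) z v) =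
      fderiv ℝ θ z.1 (vertForm (metricInChart I g.inner P.1) z v) := fun v => by
    have hQ2 : Q.2 = fderiv ℝ θ z.1 z.2 := by
      rw [← tangentCoordChange_eq_fderiv hz]
      rfl
    have hvp : ∀ u : E × E, verPart I g.inner Q u =
        u.2 + christoffel (metricInChart I g.inner q) (θ z.1) u.1 (Q.2 : E) := fun u => rfl
    rw [hvp, hfd, vertForm_apply, map_add, htr, hQ2]
    dsimp only
    abel
  have hmus : ∀ u u' : E × E, musSasaki I g.inner f Q u u' = g.inner q u.1 u'.1
      + f q * g.inner q (verPart I g.inner Q u) (verPart I g.inner Q u') := fun u u' => rfl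
  refine ContinuousLinearMap.ext fun v => ContinuousLinearMap.ext fun w => ?_
  rw [hmain, bundleMetric_apply, hmus, hver, hver, hbase, hfd, hfd, hbase]
  rfl

variable {g : Bundle.ContMDiffRiemannianMetric I ∞ E (TangentSpace I : M → Type _)} {f : M → ℝ}

theorem isFlatWeighted_metricInChart (hflat : IsFlat I g.inner) (hf : ContMDiff I 𝓘(ℝ) ∞ f)
    (hpos : ∀ x, 0 < f x) (p : M) :
    IsFlatWeighted (metricInChart I g.inner p) (f ∘ (extChartAt I p).symm)
      (extChartAt I p).target where
  metric := isMetricOn_metricInChart g p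
  flat := hflat p
  smooth := (hf.comp_contMDiffOn (contMDiffOn_extChartAt_symm p)).contDiffOn
  pos := fun _ _ => hpos _

section Germs

variable (g f) (P : TangentBundle I M)

theorem metricInChart_musSasaki_eventuallyEq {z : E × E} (hz : z.1 ∈ (extChartAt I P.1).target) :
    metricInChart I.tangent (musSasaki I g.inner f) P =ᶠ[𝓝 z]
      bundleMetric (metricInChart I g.inner P.1) (f ∘ (extChartAt I P.1).symm) := by
  filter_upwards [((isOpen_extChartAt_target (I := I) P.1).preimage continuous_fst).mem_nhds hz]
    with x hx using metricInChart_musSasaki g f P hx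

theorem metricInChart_sasaki_eventuallyEq {z : E × E} (hz : z.1 ∈ (extChartAt I P.1).target) :
    metricInChart I.tangent (sasaki I g.inner) P =ᶠ[𝓝 z]
      bundleMetric (metricInChart I g.inner P.1) (fun _ => 1) := by
  rw [← musSasaki_one]
  exact metricInChart_musSasaki_eventuallyEq g (fun _ => 1) P hz

end Germs

theorem tension_id_eq_zero_iff (hflat : IsFlat I g.inner) (hf : ContMDiff I 𝓘(ℝ) ∞ f)
    (hpos : ∀ x, 0 < f x) (P : TangentBundle I M) :
    tension I.tangent I.tangent (sasaki I g.inner) (musSasaki I g.inner f) id P = 0 ↔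
      -((Module.finrank ℝ E : ℝ) / 2) • localGrad (metricInChart I g.inner P.1)
        (f ∘ (extChartAt I P.1).symm) (extChartAt I P.1 P.1) = 0 := by
  have h := isFlatWeighted_metricInChart hflat hf hpos P.1
  have hz : (extChartAt I.tangent P P).1 ∈ (extChartAt I P.1).target := mem_extChartAt_target P.1
  have hid := writtenInExtChartAt_id_eventuallyEq P hz
  rw [tension]
  refine symmL_self_eq_zero_iff.trans ?_
  have hN : metricInChart I.tangent (musSasaki I g.inner f) (id P) =ᶠ[𝓝 (writtenInExtChartAt
      I.tangent I.tangent P (id : TangentBundle I M → TangentBundle I M) (extChartAt I.tangent P P))]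
      bundleMetric (metricInChart I g.inner P.1) (f ∘ (extChartAt I P.1).symm) := by
    rw [hid.eq_of_nhds]
    exact metricInChart_musSasaki_eventuallyEq g f P hz
  rw [localTension_congr (metricInChart_sasaki_eventuallyEq g P hz) hN hid,
    h.localTension_eq hz, liftVec_eq_zero_iff]
  rfl

theorem bitension_id_eq_zero_iff (hflat : IsFlat I g.inner) (hf : ContMDiff I 𝓘(ℝ) ∞ f)
    (hpos : ∀ x, 0 < f x) (P : TangentBundle I M) :
    bitension I.tangent I.tangent (sasaki I g.inner) (musSasaki I g.inner f) id P = 0 ↔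
      ((Module.finrank ℝ E : ℝ) / 2) •
        (traceSecondCov (metricInChart I g.inner P.1) (metricInChart I g.inner P.1) id
          (localGrad (metricInChart I g.inner P.1) (f ∘ (extChartAt I P.1).symm))
            (extChartAt I P.1 P.1)
        - ((Module.finrank ℝ E : ℝ) / 2) •
          pullbackCov (metricInChart I g.inner P.1) id
            (localGrad (metricInChart I g.inner P.1) (f ∘ (extChartAt I P.1).symm))
            (extChartAt I P.1 P.1)
            (localGrad (metricInChart I g.inner P.1) (f ∘ (extChartAt I P.1).symm)
              (extChartAt I P.1 P.1))) = 0 := by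
  have h := isFlatWeighted_metricInChart hflat hf hpos P.1
  have hz : (extChartAt I.tangent P P).1 ∈ (extChartAt I P.1).target := mem_extChartAt_target P.1
  have hid := writtenInExtChartAt_id_eventuallyEq P hz
  rw [bitension]
  refine symmL_self_eq_zero_iff.trans ?_
  have hN : metricInChart I.tangent (musSasaki I g.inner f) (id P) =ᶠ[𝓝 (writtenInExtChartAt
      I.tangent I.tangent P (id : TangentBundle I M → TangentBundle I M) (extChartAt I.tangent P P))]
      bundleMetric (metricInChart I g.inner P.1) (f ∘ (extChartAt I P.1).symm) := by
    rw [hid.eq_of_nhds]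
    exact metricInChart_musSasaki_eventuallyEq g f P hz
  rw [localBitension_congr (metricInChart_sasaki_eventuallyEq g P hz) hN hid
    (continuousAt_id.congr hid.symm),
    h.localBitension_eq hz, liftVec_eq_zero_iff]
  rfl

theorem fieldInChart_grad_eventuallyEq (hf : ContMDiff I 𝓘(ℝ) ∞ f) {p : M} {y : E}
    (hy : y ∈ (extChartAt I p).target) :
    fieldInChart I (grad I g.inner f) p =ᶠ[𝓝 y]
      localGrad (metricInChart I g.inner p) (f ∘ (extChartAt I p).symm) := by
  filter_upwards [(isOpen_extChartAt_target (I := I) p).mem_nhds hy] with x hx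
    using fieldInChart_grad g hx ((hf _).mdifferentiableAt (by simp))

theorem grad_eq_zero_iff (hf : ContMDiff I 𝓘(ℝ) ∞ f) (p : M) :
    grad I g.inner f p = 0 ↔ localGrad (metricInChart I g.inner p) (f ∘ (extChartAt I p).symm)
      (extChartAt I p p) = 0 := by
  rw [← symmL_fieldInChart_self (grad I g.inner f) p, symmL_self_eq_zero_iff,
    (fieldInChart_grad_eventuallyEq hf (mem_extChartAt_target p)).eq_of_nhds]

theorem traceHess_grad (hf : ContMDiff I 𝓘(ℝ) ∞ f) (p : M) :
    traceHess I g.inner (grad I g.inner f) p =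
      (trivializationAt E (TangentSpace I : M → Type _) p).symmL ℝ p
        (traceSecondCov (metricInChart I g.inner p) (metricInChart I g.inner p) id
          (localGrad (metricInChart I g.inner p) (f ∘ (extChartAt I p).symm))
          (extChartAt I p p)) := by
  rw [traceHess, traceSecondCov_congr .rfl .rfl .rfl continuousAt_id
    (fieldInChart_grad_eventuallyEq hf (mem_extChartAt_target p))]

theorem normSq_grad_symm (hf : ContMDiff I 𝓘(ℝ) ∞ f) {p : M} {y : E}
    (hy : y ∈ (extChartAt I p).target) :
    normSq I g.inner (grad I g.inner f) ((extChartAt I p).symm y) =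
      metricInChart I g.inner p y
        (localGrad (metricInChart I g.inner p) (f ∘ (extChartAt I p).symm) y)
        (localGrad (metricInChart I g.inner p) (f ∘ (extChartAt I p).symm) y) := by
  rw [normSq_symm _ _ hy, (fieldInChart_grad_eventuallyEq hf hy).eq_of_nhds]

/-- Needed before `fieldInChart_grad` can be applied to the function `‖grad f‖²`. -/
theorem mdifferentiableAt_normSq_grad (hf : ContMDiff I 𝓘(ℝ) ∞ f) (p : M) :
    MDifferentiableAt I 𝓘(ℝ) (normSq I g.inner (grad I g.inner f)) p := by
  have hG := isMetricOn_metricInChart g p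
  have hy := mem_extChartAt_target (I := I) p
  have hfy : ContDiffAt ℝ ∞ (f ∘ (extChartAt I p).symm) (extChartAt I p p) :=
    (hf.comp_contMDiffOn (contMDiffOn_extChartAt_symm p)).contDiffOn.contDiffAt
      (hG.isOpen.mem_nhds hy)
  have hX := hG.contDiffAt_localGrad hy hfy
  have h1 := ((hG.contDiffAt hy).clm_apply hX).clm_apply hX
  have h2 := (h1.differentiableAt (by simp)).mdifferentiableAt.comp p
    (mdifferentiableAt_extChartAt (mem_chart_source H p))
  refine h2.congr_of_eventuallyEq ?_
  filter_upwards [extChartAt_source_mem_nhds (I := I) p] with x hx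
  have := normSq_grad_symm (g := g) hf ((extChartAt I p).map_source hx)
  rwa [(extChartAt I p).left_inv hx] at this

theorem grad_normSq_grad (hf : ContMDiff I 𝓘(ℝ) ∞ f) (p : M) :
    grad I g.inner (normSq I g.inner (grad I g.inner f)) p =
      (trivializationAt E (TangentSpace I : M → Type _) p).symmL ℝ p
        ((2 : ℝ) • pullbackCov (metricInChart I g.inner p) id
          (localGrad (metricInChart I g.inner p) (f ∘ (extChartAt I p).symm)) (extChartAt I p p)
          (localGrad (metricInChart I g.inner p) (f ∘ (extChartAt I p).symm)
            (extChartAt I p p))) := by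
  have hG := isMetricOn_metricInChart g p
  have hy := mem_extChartAt_target (I := I) p
  have hfy : ContDiffAt ℝ ∞ (f ∘ (extChartAt I p).symm) (extChartAt I p p) :=
    (hf.comp_contMDiffOn (contMDiffOn_extChartAt_symm p)).contDiffOn.contDiffAt
      (hG.isOpen.mem_nhds hy)
  have hev : normSq I g.inner (grad I g.inner f) ∘ (extChartAt I p).symm
      =ᶠ[𝓝 (extChartAt I p p)] fun y => metricInChart I g.inner p y
        (localGrad (metricInChart I g.inner p) (f ∘ (extChartAt I p).symm) y)
        (localGrad (metricInChart I g.inner p) (f ∘ (extChartAt I p).symm) y) := by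
    filter_upwards [hG.isOpen.mem_nhds hy] with y hy using normSq_grad_symm hf hy
  rw [← symmL_fieldInChart_self (grad I g.inner (normSq I g.inner (grad I g.inner f))) p,
    fieldInChart_grad g hy (by
      rw [extChartAt_to_inv]
      exact mdifferentiableAt_normSq_grad hf p), ← hG.localGrad_normSq hy hfy, localGrad,
    hev.fderiv_eq, localGrad]

end MusSasakiChart

/-! ### Harmonicity and biharmonicity of the identity -/

section Main

variable {m : ℕ} {M : Type*} [TopologicalSpace M]
    [ChartedSpace (EuclideanSpace ℝ (Fin m)) M] [IsManifold (𝓡 m) ∞ M]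
    {g : Bundle.ContMDiffRiemannianMetric (𝓡 m) ∞ (EuclideanSpace ℝ (Fin m))
      (TangentSpace (𝓡 m) : M → Type _)} {f : M → ℝ}

theorem isHarmonic_id_iff (hflat : IsFlat (𝓡 m) g.inner) (hf : ContMDiff (𝓡 m) 𝓘(ℝ) ∞ f)
    (hpos : ∀ x, 0 < f x) :
    IsHarmonic (𝓡 m).tangent (𝓡 m).tangent (sasaki (𝓡 m) g.inner) (musSasaki (𝓡 m) g.inner f)
        (id : TangentBundle (𝓡 m) M → TangentBundle (𝓡 m) M) ↔
      ∀ x, grad (𝓡 m) g.inner f x = 0 := by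
  have key : ∀ P : TangentBundle (𝓡 m) M,
      tension (𝓡 m).tangent (𝓡 m).tangent (sasaki (𝓡 m) g.inner) (musSasaki (𝓡 m) g.inner f) id P
        = 0 ↔ grad (𝓡 m) g.inner f P.1 = 0 := fun P => by
    rw [tension_id_eq_zero_iff hflat hf hpos, grad_eq_zero_iff hf, finrank_euclideanSpace_fin]
    -- For `m = 0` the factor `-m/2` cannot be divided out, but the tangent spaces are trivial.
    rcases Nat.eq_zero_or_pos m with rfl | hm
    · exact iff_of_true (Subsingleton.elim _ _) (Subsingleton.elim _ _)
    · have : (0 : ℝ) < m := by exact_mod_cast hm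
      rw [smul_eq_zero_iff_right (by linarith : -((m : ℝ) / 2) ≠ 0)]
  -- The condition at `(x, u)` does not involve `u`, so the zero section tests all points of `M`.
  exact ⟨fun h x => (key ⟨x, 0⟩).1 (h.2 _), fun h => ⟨contMDiff_id, fun P => (key P).2 (h P.1)⟩⟩

theorem isBiharmonic_id_iff (hflat : IsFlat (𝓡 m) g.inner) (hf : ContMDiff (𝓡 m) 𝓘(ℝ) ∞ f)
    (hpos : ∀ x, 0 < f x) :
    IsBiharmonic (𝓡 m).tangent (𝓡 m).tangent (sasaki (𝓡 m) g.inner) (musSasaki (𝓡 m) g.inner f)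
        (id : TangentBundle (𝓡 m) M → TangentBundle (𝓡 m) M) ↔
      ∀ x : M, ((m : ℝ) / 4) • grad (𝓡 m) g.inner
          (normSq (𝓡 m) g.inner (grad (𝓡 m) g.inner f)) x =
        traceHess (𝓡 m) g.inner (grad (𝓡 m) g.inner f) x := by
  have key : ∀ P : TangentBundle (𝓡 m) M,
      bitension (𝓡 m).tangent (𝓡 m).tangent (sasaki (𝓡 m) g.inner) (musSasaki (𝓡 m) g.inner f) id P
        = 0 ↔ ((m : ℝ) / 4) • grad (𝓡 m) g.inner
          (normSq (𝓡 m) g.inner (grad (𝓡 m) g.inner f)) P.1 =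
        traceHess (𝓡 m) g.inner (grad (𝓡 m) g.inner f) P.1 := fun P => by
    -- The factor `2` of `grad ‖X‖² = 2 ∇_X X` turns `m/4` into the `m/2` of the bitension field.
    rw [bitension_id_eq_zero_iff hflat hf hpos, traceHess_grad hf, grad_normSq_grad hf,
      eq_comm (a := ((m : ℝ) / 4) • _), ← sub_eq_zero (b := ((m : ℝ) / 4) • _), ← map_smul,
      ← map_sub, symmL_self_eq_zero_iff, finrank_euclideanSpace_fin, smul_smul,
      show (m : ℝ) / 4 * 2 = m / 2 by ring]
    rcases Nat.eq_zero_or_pos m with rfl | hm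
    · exact iff_of_true (Subsingleton.elim _ _) (Subsingleton.elim _ _)
    · have : (0 : ℝ) < m := by exact_mod_cast hm
      rw [smul_eq_zero_iff_right (by linarith : (m : ℝ) / 2 ≠ 0)]
  exact ⟨fun h x => (key ⟨x, 0⟩).1 (h.2 _), fun h => ⟨contMDiff_id, fun P => (key P).2 (h P.1)⟩⟩

end Main

end MusSasaki

end

theorem theorem5p4 {m : ℕ} {M : Type*} [TopologicalSpace M]
    [ChartedSpace (EuclideanSpace ℝ (Fin m)) M] [IsManifold (𝓡 m) ∞ M]
    (g : Bundle.ContMDiffRiemannianMetric (𝓡 m) ∞ (EuclideanSpace ℝ (Fin m))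
      (TangentSpace (𝓡 m) : M → Type _))
    (hflat : MusSasaki.IsFlat (𝓡 m) g.inner)
    (f : M → ℝ) (hf : ContMDiff (𝓡 m) 𝓘(ℝ) ∞ f) (hpos : ∀ x, 0 < f x) :
    (MusSasaki.IsBiharmonic (𝓡 m).tangent (𝓡 m).tangent
        (MusSasaki.sasaki (𝓡 m) g.inner) (MusSasaki.musSasaki (𝓡 m) g.inner f)
        (id : TangentBundle (𝓡 m) M → TangentBundle (𝓡 m) M) ↔
      ∀ x : M,
        ((m : ℝ) / 4) • MusSasaki.grad (𝓡 m) g.inner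
            (MusSasaki.normSq (𝓡 m) g.inner (MusSasaki.grad (𝓡 m) g.inner f)) x =
          MusSasaki.traceHess (𝓡 m) g.inner (MusSasaki.grad (𝓡 m) g.inner f) x) ∧
    (MusSasaki.IsProperBiharmonic (𝓡 m).tangent (𝓡 m).tangent
        (MusSasaki.sasaki (𝓡 m) g.inner) (MusSasaki.musSasaki (𝓡 m) g.inner f)
        (id : TangentBundle (𝓡 m) M → TangentBundle (𝓡 m) M) ↔
      (∃ x : M, MusSasaki.grad (𝓡 m) g.inner f x ≠ 0) ∧
      ∀ x : M,
        ((m : ℝ) / 4) • MusSasaki.grad (𝓡 m) g.inner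
            (MusSasaki.normSq (𝓡 m) g.inner (MusSasaki.grad (𝓡 m) g.inner f)) x =
          MusSasaki.traceHess (𝓡 m) g.inner (MusSasaki.grad (𝓡 m) g.inner f) x) := by
  refine ⟨MusSasaki.isBiharmonic_id_iff hflat hf hpos, ?_⟩
  rw [MusSasaki.IsProperBiharmonic, MusSasaki.isBiharmonic_id_iff hflat hf hpos,
    MusSasaki.isHarmonic_id_iff hflat hf hpos, not_forall, and_comm]
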